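/- Let $a_1,a_2,p_1,p_2>0$, $T=p_1+p_2$. Let $f_0(x)=-\operatorname{sign}(x)$ and let $A_0$ be the $T$-periodic function equal to $a_1$ on $[0,p_1)$ and to $a_2$ on $[p_1,T)$. For small $\delta>0$ let $f_\delta$ and $A_\delta$ be the continuous functions obtained from $f_0$ and $A_0$ by replacing each jump, on the $\delta$-neighbourhood of the jump, by the line segment joining the two constant levels; thus $f_\delta(x)=1$ for $x\le-\delta$, $f_\delta(x)=-1$ for $x\ge\delta$, $f_\delta(x)=-x/\delta$ for $|x|<\delta$, and $A_\delta$ is $T$-periodic, affine on $[-\delta,\delta]$ and on $[p_1-\delta,p_1+\delta]$, equal to $a_1$ on $[\delta,p_1-\delta]$ and to $a_2$ on $[p_1+\delta,T-\delta]$. Consider for $\delta\ge 0$ the delay differential equation $$x'(t)=A_\delta(t)\,f_\delta(x(t-1)),\qquad(E_\delta)$$ understood in integrated form $x(t)=x(0)+\int_0^tA_\delta(s)f_\delta(x(s-1))\,ds$, $t\ge0$, with initial functions in $C([-1,0],\mathbb R)$ with the sup norm. Stability, asymptotic stability and instability of a solution are meant in the sense of Lyapunov for perturbations of its initial function on $[-1,0]$.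 Put $m=2\frac{a_2}{a_1}-1$, $b=a_1(p_1-2)+a_2\,(6-2p_1-p_2)$, $k=1-2\frac{a_2}{a_1}$, $d=a_1p_1+a_2(2-2p_1-p_2)$. Suppose that one of the following holds. (Ia) $|m|<1$, $b>0$; or (Ib) $m>1$, $b<0$; in both cases, with $h_*=b/(m-1)<0$ and $t_1=-h_*/a_1$, assume $t_1+2<p_1<t_1+3<T$ (the solution starting from the constant initial function $h_*$ has on $[0,T]$ exactly the two zeros $t_1$ and $t_1+2$, both before $p_1$, and after its second zero it attains its minimum at $t_1+3$, strictly between $p_1$ and $T$). Put $P=T$. (II) $|k|<1$, $d>0$ and, with $h_*=-d/(k+1)<0$ and $t_1=-h_*/a_1$, $t_1<p_1<t_1+1<T$ (the solution starting from the constant initial function $h_*$ has on $[0,T]$ exactly one zero, $t_1<p_1$, and attains its maximum at $t_1+1$, strictly between $p_1$ and $T$). Put $P=2T$. Then there are $\delta_0>0$ and functions $x_\delta:\mathbb R\to\mathbb R$, $0\le\delta\le\delta_0$, such that: 1. for every $0\le\delta\le\delta_0$, $x_\delta$ is a $P$-periodic solution of $(E_\delta)$, which is asymptotically stable in the cases (Ia)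 and (II) and unstable in the case (Ib); 2. for $0<\delta\le\delta_0$, $x_\delta$ is of class $C^1$ and satisfies $(E_\delta)$ at every $t\in\mathbb R$; 3. $x_0$ is the periodic solution with corners of the piecewise constant equation $(E_0)$, i.e. it coincides for $t\ge0$ with the solution of $(E_0)$ with the constant initial function $h_*$; 4. $x_\delta\to x_0$ uniformly on $\mathbb R$ as $\delta\to0+$. -/

import Mathlib

open Set Filter Topology

noncomputable section

/-- The nonlinearity: `f_0 = -sign`, and for `δ > 0` the continuous piecewise affine function
`f_δ` that joins the values `+1` and `-1` linearly across `(-δ, δ)`. -/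
def fSmooth (δ x : ℝ) : ℝ :=
  if δ = 0 then -Real.sign x
  else if x ≤ -δ then 1
  else if δ ≤ x then -1
  else -(1 / δ) * x

/-- The representative in `[0, T)` of `t` modulo `T` (for `T > 0`). -/
def modPeriod (T t : ℝ) : ℝ := Int.fract (t / T) * T

/-- The `(p₁ + p₂)`-periodic piecewise constant coefficient: `a₁` on `[0, p₁)` and
`a₂` on `[p₁, p₁ + p₂)`. -/
def coeffStep (a₁ a₂ p₁ p₂ t : ℝ) : ℝ :=
  if modPeriod (p₁ + p₂) t < p₁ then a₁ else a₂

/-- The values on `[0, p₁ + p₂)` of the continuous coefficient `A_δ`, `δ > 0`: each jump of the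
step coefficient (at `0`, `p₁` and `p₁ + p₂`) is replaced by a line segment over the
`δ`-neighbourhood of the jump. -/
def coeffRamp (δ a₁ a₂ p₁ p₂ r : ℝ) : ℝ :=
  if r < δ then a₂ + (a₁ - a₂) / (2 * δ) * (r + δ)
  else if r ≤ p₁ - δ then a₁
  else if r < p₁ + δ then a₁ + (a₂ - a₁) / (2 * δ) * (r - (p₁ - δ))
  else if r ≤ p₁ + p₂ - δ then a₂
  else a₂ + (a₁ - a₂) / (2 * δ) * (r - (p₁ + p₂ - δ))

/-- The coefficient: `A_0` is the step coefficient, and for `δ > 0` (small) `A_δ` is its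
continuous, periodic, piecewise affine modification. -/
def ASmooth (a₁ a₂ p₁ p₂ δ t : ℝ) : ℝ :=
  if δ = 0 then coeffStep a₁ a₂ p₁ p₂ t
  else coeffRamp δ a₁ a₂ p₁ p₂ (modPeriod (p₁ + p₂) t)

/-- `x` is a solution, for `t ≥ 0`, of `x'(t) = a(t) f(x(t - 1))` with continuous initial function
`x|_{[-1, 0]}`. The equation is integrated, because `a` and `f` may have jumps; for continuous
`a` and `f` this is the same as the differential equation. Values of `x` on `(-∞, -1)` play no
role. -/
def IsSolution (a f x : ℝ → ℝ) : Prop :=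
  ContinuousOn x (Ici (-1)) ∧
    ∀ t : ℝ, 0 ≤ t →
      IntervalIntegrable (fun s => a s * f (x (s - 1))) MeasureTheory.volume 0 t ∧
      x t = x 0 + ∫ s in (0 : ℝ)..t, a s * f (x (s - 1))

/-- Lyapunov stability of the solution `x`, with respect to perturbations of its initial function
in the space `C([-1, 0])` with the sup norm. -/
def IsStable (a f x : ℝ → ℝ) : Prop :=
  ∀ ε : ℝ, 0 < ε → ∃ η : ℝ, 0 < η ∧ ∀ y : ℝ → ℝ, IsSolution a f y →
    (∀ s ∈ Icc (-1 : ℝ) 0, |y s - x s| < η) → ∀ t : ℝ, 0 ≤ t → |y t - x t| < ε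

/-- Asymptotic stability: stability together with local attractivity. -/
def IsAsymptoticallyStable (a f x : ℝ → ℝ) : Prop :=
  IsStable a f x ∧
    ∃ η : ℝ, 0 < η ∧ ∀ y : ℝ → ℝ, IsSolution a f y →
      (∀ s ∈ Icc (-1 : ℝ) 0, |y s - x s| < η) → Tendsto (fun t => y t - x t) atTop (𝓝 0)

/-- Instability: failure of stability. -/
def IsUnstable (a f x : ℝ → ℝ) : Prop := ¬ IsStable a f x

/-- The slope `m` of the return map `G(h) = m h - b` (type I). -/
def mI (a₁ a₂ : ℝ) : ℝ := 2 * (a₂ / a₁) - 1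

/-- The constant `b` of the return map `G(h) = m h - b` (type I). -/
def bI (a₁ a₂ p₁ p₂ : ℝ) : ℝ := a₁ * (p₁ - 2) + a₂ * (6 - (2 * p₁ + p₂))

/-- The fixed point `h_* = b / (m - 1)` (type I). -/
def hI (a₁ a₂ p₁ p₂ : ℝ) : ℝ := bI a₁ a₂ p₁ p₂ / (mI a₁ a₂ - 1)

/-- The slope `k` of the map `F₁(h) = k h + d` (type II). -/
def kII (a₁ a₂ : ℝ) : ℝ := 1 - 2 * (a₂ / a₁)

/-- The constant `d` of the map `F₁(h) = k h + d` (type II). -/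
def dII (a₁ a₂ p₁ p₂ : ℝ) : ℝ := a₁ * p₁ + a₂ * (2 - 2 * p₁ - p₂)

/-- The fixed point `h_* = -d / (k + 1)` (type II). -/
def hII (a₁ a₂ p₁ p₂ : ℝ) : ℝ := -dII a₁ a₂ p₁ p₂ / (kII a₁ a₂ + 1)

/-- The shape of the type I solution. Its first zero is `t₁ = -h_* / a₁`; its second zero `t₁ + 2`
lies before `p₁`, and its minimum `t₁ + 3` lies between `p₁` and the end of the period. -/
def ShapeI (a₁ a₂ p₁ p₂ : ℝ) : Prop :=
  -hI a₁ a₂ p₁ p₂ / a₁ + 2 < p₁ ∧ p₁ < -hI a₁ a₂ p₁ p₂ / a₁ + 3 ∧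
    -hI a₁ a₂ p₁ p₂ / a₁ + 3 < p₁ + p₂

/-- The shape of the type II solution. Its zero `t₁ = -h_* / a₁` lies before `p₁`, and its maximum
`t₁ + 1` lies between `p₁` and the end of the coefficient's period. -/
def ShapeII (a₁ a₂ p₁ p₂ : ℝ) : Prop :=
  -hII a₁ a₂ p₁ p₂ / a₁ < p₁ ∧ p₁ < -hII a₁ a₂ p₁ p₂ / a₁ + 1 ∧
    -hII a₁ a₂ p₁ p₂ / a₁ + 1 < p₁ + p₂

/-- There is `δ₀ > 0` and a family of functions `x δ`, `0 ≤ δ ≤ δ₀`, such that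
* `x δ` is a `P`-periodic solution of the equation with `f_δ`, `A_δ`, of stability type `S`;
* for `δ > 0` it is of class `C¹` and solves the differential equation at every time;
* for `δ = 0` it coincides for `t ≥ 0` with the solution whose initial function is the
  constant `h`;
* `x δ` converges to `x 0` uniformly on the line as `δ → 0+`. -/
def SmoothedPeriodicFamily (a₁ a₂ p₁ p₂ P h : ℝ)
    (S : (ℝ → ℝ) → (ℝ → ℝ) → (ℝ → ℝ) → Prop) : Prop :=
  ∃ δ₀ : ℝ, 0 < δ₀ ∧ ∃ x : ℝ → ℝ → ℝ,
    (∀ δ : ℝ, 0 ≤ δ → δ ≤ δ₀ →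
      Function.Periodic (x δ) P ∧
      IsSolution (ASmooth a₁ a₂ p₁ p₂ δ) (fSmooth δ) (x δ) ∧
      S (ASmooth a₁ a₂ p₁ p₂ δ) (fSmooth δ) (x δ)) ∧
    (∀ δ : ℝ, 0 < δ → δ ≤ δ₀ →
      ContDiff ℝ 1 (x δ) ∧
      ∀ t : ℝ, HasDerivAt (x δ) (ASmooth a₁ a₂ p₁ p₂ δ t * fSmooth δ (x δ (t - 1))) t) ∧
    (∃ y : ℝ → ℝ, IsSolution (ASmooth a₁ a₂ p₁ p₂ 0) (fSmooth 0) y ∧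
      (∀ s ∈ Icc (-1 : ℝ) 0, y s = h) ∧ ∀ t : ℝ, 0 ≤ t → x 0 t = y t) ∧
    TendstoUniformly x (x 0) (𝓝[>] (0 : ℝ))

end

noncomputable section

open MeasureTheory

/-! An initial function that lies below `-δ` on `[-1, 0]` is seen by `f_δ` only as the constant `1`,
so the solution depends on its value at `0` alone. If the solution is again below `-δ` one delay
before the end of the period, then near the periodic orbit the infinite-dimensional dynamics reduces
to a scalar map of initial values.

This map is exactly affine, with the same slope for every small `δ`, for two reasons. A solution
crosses zero along a line of slope `±a₁`, and one delay later the coefficient is constant while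
`f_δ` switches. Since `f_δ` is odd, the integral over the switching window vanishes, as if the
switch were a jump at its centre (`integral_mul_fSmooth_of_ge`). The ramps of the coefficient are
symmetric as well: the one at `p₁` adds nothing in total, and the half-ramp at `0` adds `(a₂ - a₁) /
4 * δ` (`integral_ASmooth_left`), which the half-ramp at the end of the period removes. Writing the
initial value as `H - (a₂ - a₁) / 4 * δ` absorbs this offset, so the fixed point is `h_* - (a₂ - a₁)
/ 4 * δ`. The slope is `m` in type I. In type II one coefficient period followed by a sign change
has slope `-k`, and by oddness two such steps give a return map of slope `k ^ 2`
(`ReturnMap.comp_neg`).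

To verify the shape of solutions, a guess `φ` that is right only as far as `f_δ` can tell is
inserted in the right-hand side. If the resulting integral is indistinguishable from `φ` under
`f_δ`, it is the solution (`IsSolution.eq_profileSolution`). The guess is a line in type II and a
tent in type I. The inequalities needed are strict at `δ = 0`, `H = h_*`, hence persist nearby.

Stability and instability follow by iterating the affine map (`ReturnMap.isAsymptoticallyStable`,
`ReturnMap.isUnstable`). Continuous dependence within a period and convergence as `δ → 0+` are both
dominated convergence (`eventually_abs_primitive_sub_lt`). -/

/-- The function `y` stays below `-δ` on the initial interval `[-1, 0]`. -/
def BelowOnDelay (δ : ℝ) (y : ℝ → ℝ) : Prop := ∀ s ∈ Icc (-1 : ℝ) 0, y s < -δ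

/-! ### Symmetries of the equation and existence by the method of steps -/

theorem IsSolution.shift {a f y : ℝ → ℝ} (hy : IsSolution a f y) {P : ℝ} (hP : 0 ≤ P)
    (ha : Function.Periodic a P) : IsSolution a f (fun t => y (t + P)) := by
  obtain ⟨hc, hy⟩ := hy
  refine ⟨hc.comp (by fun_prop) fun t ht => ?_, fun t ht => ?_⟩
  · simp only [mem_Ici] at ht ⊢; linarith
  have e : (fun s => a s * f (y (s - 1 + P))) = fun s => a (s + P) * f (y (s + P - 1)) := by
    funext s; rw [ha s]; ring_nf
  obtain ⟨i1, e1⟩ := hy P hP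
  obtain ⟨i2, e2⟩ := hy (t + P) (by linarith)
  have i3 : IntervalIntegrable (fun s => a s * f (y (s - 1))) volume P (t + P) := i1.symm.trans i2
  rw [e]
  constructor
  · have := i3.comp_add_right P
    simpa using this
  · rw [intervalIntegral.integral_comp_add_right (fun s => a s * f (y (s - 1)))]
    beta_reduce
    rw [zero_add, e2, e1,
      ← intervalIntegral.integral_add_adjacent_intervals i1 i3]
    ring

/-- Together with the time shift, this symmetry lets the type II orbit, of period `2 * T`, be
studied on `[0, T]` only. -/
theorem IsSolution.neg {a f y : ℝ → ℝ} (hy : IsSolution a f y) (hf : ∀ x, f (-x) = -f x) :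
    IsSolution a f (fun t => -y t) := by
  refine ⟨hy.1.neg, fun t ht => ?_⟩
  obtain ⟨i, e⟩ := hy.2 t ht
  have e' : (fun s => a s * f (-y (s - 1))) = fun s => -(a s * f (y (s - 1))) := by
    funext s; rw [hf]; ring
  rw [e']
  refine ⟨i.neg, ?_⟩
  beta_reduce
  rw [e, intervalIntegral.integral_neg]; ring

/-- Method of steps: the delay `1` makes the right-hand side on `[n, n + 1]` a function of the
values up to `n`, so no regularity of `f` beyond measurability and boundedness is needed. -/
theorem exists_isSolution {a f : ℝ → ℝ} (ha : Measurable a) (hf : Measurable f) {M : ℝ}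
    (haM : ∀ t, |a t| ≤ M) (hf1 : ∀ x, |f x| ≤ 1) {φ : ℝ → ℝ} (hφ : Continuous φ) :
    ∃ y, IsSolution a f y ∧ ∀ s ≤ 0, y s = φ s := by
  -- Clamping by `min t 0` and `max t 0` gives one formula on the whole line. The iterate `Y n` is
  -- final on `(-∞, n]`.
  let Y : ℕ → ℝ → ℝ := fun n => Nat.rec (fun t => φ (min t 0))
    (fun _ y t => φ (min t 0) + ∫ s in (0 : ℝ)..(max t 0), a s * f (y (s - 1))) n
  have Ys : ∀ n t, Y (n + 1) t =
      φ (min t 0) + ∫ s in (0 : ℝ)..(max t 0), a s * f (Y n (s - 1)) := fun _ _ => rfl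
  have M0 : 0 ≤ M := (abs_nonneg _).trans (haM 0)
  have hint : ∀ z : ℝ → ℝ, Continuous z → ∀ u v : ℝ,
      IntervalIntegrable (fun s => a s * f (z (s - 1))) volume u v := by
    intro z hz u v
    refine (intervalIntegrable_const (c := M)).mono_fun' ?_ ?_
    · exact (ha.mul (hf.comp (hz.measurable.comp (by fun_prop)))).aestronglyMeasurable
    · refine Eventually.of_forall fun s => ?_
      beta_reduce
      rw [Real.norm_eq_abs, abs_mul]
      exact (mul_le_mul (haM _) (hf1 _) (abs_nonneg _) M0).trans_eq (mul_one M)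
  have Yc : ∀ n, Continuous (Y n) := by
    intro n
    induction n with
    | zero => exact hφ.comp (by fun_prop)
    | succ n ih =>
      have := intervalIntegral.continuous_primitive (hint _ ih) 0
      exact (hφ.comp (by fun_prop)).add (this.comp (by fun_prop))
  have Ystep : ∀ n : ℕ, ∀ t : ℝ, t ≤ n → Y (n + 1) t = Y n t := by
    intro n
    induction n with
    | zero =>
      intro t ht
      rw [Ys, max_eq_right (by simpa using ht)]
      simp [Y]
    | succ n ih =>
      intro t ht
      rw [Ys (n + 1), Ys n]
      congr 1
      refine intervalIntegral.integral_congr fun s hs => ?_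
      rw [uIcc_of_le (le_max_right _ _)] at hs
      have : s ≤ n + 1 := hs.2.trans (max_le (by exact_mod_cast ht) (by positivity))
      rw [ih (s - 1) (by linarith)]
  have Ymono : ∀ m n : ℕ, m ≤ n → ∀ t : ℝ, t ≤ m → Y n t = Y m t := by
    intro m n hmn
    induction n, hmn using Nat.le_induction with
    | base => exact fun _ _ => rfl
    | succ n hmn ih =>
      intro t ht
      rw [Ystep n t (ht.trans (by exact_mod_cast hmn)), ih t ht]
  let y : ℝ → ℝ := fun t => Y ⌈t⌉₊ t
  have hyY : ∀ n : ℕ, ∀ t : ℝ, t ≤ n → y t = Y n t := fun n t ht =>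
    (Ymono _ n (Nat.ceil_le.2 ht) t (Nat.le_ceil t)).symm
  refine ⟨y, ⟨?_, fun t ht => ?_⟩, fun s hs => ?_⟩
  · refine Continuous.continuousOn (continuous_iff_continuousAt.2 fun t => ?_)
    obtain ⟨n, hn⟩ := exists_nat_gt t
    refine (Yc n).continuousAt.congr ?_
    filter_upwards [Iio_mem_nhds hn] with s hs using (hyY n s (le_of_lt hs)).symm
  · obtain ⟨n, hn⟩ := exists_nat_gt t
    have e : ∀ s ∈ uIcc 0 t, a s * f (Y n (s - 1)) = a s * f (y (s - 1)) := by
      intro s hs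
      rw [uIcc_of_le ht] at hs
      rw [hyY n (s - 1) (by linarith [hs.2])]
    refine ⟨(hint _ (Yc n) 0 t).congr fun s hs => e s (uIoc_subset_uIcc hs), ?_⟩
    rw [← intervalIntegral.integral_congr e, hyY (n + 1) t (by push_cast; linarith),
      hyY (n + 1) 0 (by positivity), Ys, Ys, max_eq_left ht, min_eq_right ht]
    simp
  · rw [hyY 0 s (by simpa using hs)]
    simp [Y, min_eq_left hs]

/-! ### Reduction modulo the period and periodic extension -/

theorem modPeriod_eq_self {T t : ℝ} (h0 : 0 ≤ t) (hT : t < T) : modPeriod T t = t := by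
  have : 0 < T := h0.trans_lt hT
  rw [modPeriod, Int.fract_eq_self.2 ⟨by positivity, (div_lt_one this).2 hT⟩]
  field_simp

theorem modPeriod_mem {T : ℝ} (hT : 0 < T) (t : ℝ) : modPeriod T t ∈ Ico 0 T :=
  ⟨mul_nonneg (Int.fract_nonneg _) hT.le, by
    simpa [modPeriod] using mul_lt_mul_of_pos_right (Int.fract_lt_one (t / T)) hT⟩

theorem modPeriod_periodic {T : ℝ} (hT : 0 < T) : Function.Periodic (modPeriod T) T := by
  intro t
  rw [modPeriod, modPeriod, add_div, div_self hT.ne', Int.fract_add_one]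

theorem Function.Periodic.modPeriod_eq {T : ℝ} (hT : 0 < T) {g : ℝ → ℝ}
    (hg : Function.Periodic g T) (t : ℝ) : g (modPeriod T t) = g t := by
  have : modPeriod T t = t - ⌊t / T⌋ * T := by
    rw [modPeriod, Int.fract, sub_mul, div_mul_cancel₀ _ hT.ne']
  rw [this, hg.sub_int_mul_eq]

theorem measurable_modPeriod (T : ℝ) : Measurable (modPeriod T) :=
  (measurable_fract.comp (measurable_id.div_const T)).mul_const T

theorem continuous_comp_modPeriod {T : ℝ} (hT : 0 < T) {g : ℝ → ℝ} (hg : ContinuousOn g (Icc 0 T))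
    (h0 : g 0 = g T) : Continuous fun t => g (modPeriod T t) := by
  have h : ContinuousOn (fun u => g (u * T)) (Icc 0 1) :=
    hg.comp (by fun_prop) fun u hu => ⟨mul_nonneg hu.1 hT.le, by nlinarith [hu.2]⟩
  exact (ContinuousOn.comp_fract'' h (by simpa using h0)).comp (continuous_id.div_const T)

/-- A solution that returns after time `P` to its initial value, and whose values on `[-1, 0]` and
`[P - 1, P]` lie in the region where `f = 1`, generates a `P`-periodic solution. -/
theorem IsSolution.periodicExtension {a f y : ℝ → ℝ} {δ P : ℝ} (hP : 1 ≤ P)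
    (ha : Function.Periodic a P) (hf : ∀ x < -δ, f x = 1) (hy : IsSolution a f y)
    (h0 : BelowOnDelay δ y) (h1 : BelowOnDelay δ fun t => y (t + P)) (hret : y P = y 0) :
    Continuous (fun t => y (modPeriod P t)) ∧ BelowOnDelay δ (fun t => y (modPeriod P t)) ∧
      (∀ t ∈ Icc 0 P, y (modPeriod P t) = y t) ∧
      (∀ u v, IntervalIntegrable (fun s => a s * f (y (modPeriod P (s - 1)))) volume u v) ∧
      ∀ t, y (modPeriod P t) =
        y (modPeriod P 0) + ∫ s in (0 : ℝ)..t, a s * f (y (modPeriod P (s - 1))) := by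
  have P0 : 0 < P := by linarith
  set x : ℝ → ℝ := fun t => y (modPeriod P t) with hx
  have xper : Function.Periodic x P := fun t => by simp only [hx, modPeriod_periodic P0 t]
  have xc : Continuous x :=
    continuous_comp_modPeriod P0 (hy.1.mono fun t ht => by
      simp only [mem_Ici]; linarith [ht.1]) hret.symm
  have xy : ∀ t ∈ Icc 0 P, x t = y t := by
    intro t ht
    rcases ht.2.lt_or_eq with h | h
    · simp only [hx, modPeriod_eq_self ht.1 h]
    · rw [h, hret, ← zero_add P, xper 0]
      simp only [hx, modPeriod_eq_self le_rfl P0]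
  have xb : BelowOnDelay δ x := by
    intro s hs
    rw [← xper s, xy (s + P) ⟨by linarith [hs.1], by linarith [hs.2]⟩]
    exact h1 s hs
  have gper : Function.Periodic (fun s => a s * f (x (s - 1))) P := by
    intro s
    have : x (s + P - 1) = x (s - 1) := by rw [← xper (s - 1)]; ring_nf
    simp only [ha s, this]
  -- On `[-1, 0]` the extension may differ from `y`, but both are below `-δ` there, so `f` takes the
  -- value `1` on both.
  have gy : ∀ s ∈ Icc 0 P, a s * f (y (s - 1)) = a s * f (x (s - 1)) := by
    intro s hs
    rcases le_or_gt s 1 with h | h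
    · rw [hf _ (h0 _ ⟨by linarith [hs.1], by linarith⟩), hf _ (xb _ ⟨by linarith [hs.1], by linarith⟩)]
    · rw [xy (s - 1) ⟨by linarith, by linarith [hs.2]⟩]
  have gint : ∀ u v, IntervalIntegrable (fun s => a s * f (x (s - 1))) volume u v := by
    refine gper.intervalIntegrable₀ P0.ne' ((hy.2 P P0.le).1.congr fun s hs => ?_)
    rw [uIoc_of_le P0.le] at hs
    exact gy s ⟨hs.1.le, hs.2⟩
  have gform : ∀ t ∈ Icc 0 P, x t = x 0 + ∫ s in (0 : ℝ)..t, a s * f (x (s - 1)) := by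
    intro t ht
    rw [xy t ht, xy 0 ⟨le_rfl, P0.le⟩, (hy.2 t ht.1).2]
    congr 1
    refine intervalIntegral.integral_congr fun s hs => ?_
    rw [uIcc_of_le ht.1] at hs
    exact gy s ⟨hs.1, hs.2.trans ht.2⟩
  have gzero : ∫ s in (0 : ℝ)..P, a s * f (x (s - 1)) = 0 := by
    have := gform P ⟨P0.le, le_rfl⟩
    rw [xy P ⟨P0.le, le_rfl⟩, xy 0 ⟨le_rfl, P0.le⟩, hret] at this
    linarith
  -- The defect in the integral equation is periodic because the integrand has zero mean. It is
  -- constant on one period, hence everywhere.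
  have Dper : Function.Periodic (fun t => x t - ∫ s in (0 : ℝ)..t, a s * f (x (s - 1))) P := by
    intro t
    have := gper.intervalIntegral_add_eq t 0
    rw [zero_add, gzero] at this
    beta_reduce
    rw [xper t, ← intervalIntegral.integral_add_adjacent_intervals (gint 0 t) (gint t (t + P)), this,
      add_zero]
  refine ⟨xc, xb, xy, gint, fun t => ?_⟩
  have e := Dper.modPeriod_eq P0 t
  have m := modPeriod_mem P0 t
  have := gform _ ⟨m.1, m.2.le⟩
  beta_reduce at e
  change x t = x 0 + ∫ s in (0 : ℝ)..t, a s * f (x (s - 1))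
  linarith

/-! ### Scalar return maps and Lyapunov stability -/

/-- Near `h`, the solutions starting below `-δ` are mapped, after time `P` and up to the sign `σ`,
to solutions starting below `-δ`, their initial values being transformed by the affine map of slope
`q` that fixes `h`; on `[0, P]` they depend continuously on the initial value at `h`. -/
structure ReturnMap (a f : ℝ → ℝ) (δ P σ q h r : ℝ) : Prop where
  ret : ∀ y, IsSolution a f y → BelowOnDelay δ y → |y 0 - h| < r →
    BelowOnDelay δ (fun t => σ * y (t + P)) ∧ σ * y P - h = q * (y 0 - h)
  cont : ∀ ε > 0, ∃ η > 0, ∀ y z, IsSolution a f y → IsSolution a f z → BelowOnDelay δ y →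
    BelowOnDelay δ z → z 0 = h → |y 0 - h| < η → ∀ t ∈ Icc 0 P, |y t - z t| < ε

theorem ReturnMap.comp_neg {a f : ℝ → ℝ} {δ P q h r : ℝ} (hP : 0 ≤ P) (hr : 0 < r)
    (ha : Function.Periodic a P) (hf : ∀ x, f (-x) = -f x) (hq : |q| < 1)
    (H : ReturnMap a f δ P (-1) q h r) : ReturnMap a f δ (2 * P) 1 (q ^ 2) h r := by
  have hq' : ∀ u : ℝ, |q * u| ≤ |u| := fun u => by
    rw [abs_mul]; nlinarith [abs_nonneg u]
  have sol : ∀ y, IsSolution a f y → IsSolution a f fun t => -1 * y (t + P) := fun y hy => by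
    simpa using (hy.shift hP ha).neg hf
  constructor
  · intro y hy hb h0
    obtain ⟨b1, e1⟩ := H.ret y hy hb h0
    have e1' : -1 * y (0 + P) - h = q * (y 0 - h) := by rw [zero_add]; exact e1
    obtain ⟨b2, e2⟩ := H.ret _ (sol y hy) b1 (by rw [e1']; exact (hq' _).trans_lt h0)
    rw [e1'] at e2
    constructor
    · intro s hs
      have := b2 s hs
      have e : s + 2 * P = s + P + P := by ring
      simp only [e]
      linarith
    · have e : 2 * P = P + P := by ring
      rw [e, pow_two, mul_assoc, ← e2]; ring
  · intro ε hε
    obtain ⟨η, hη, hc⟩ := H.cont ε hε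
    refine ⟨min η r, lt_min hη hr, fun y z hy hz by_ bz z0 y0 t ht => ?_⟩
    rcases le_or_gt t P with h | h'
    · exact hc y z hy hz by_ bz z0 (y0.trans_le (min_le_left _ _)) t ⟨ht.1, h⟩
    · obtain ⟨b1, e1⟩ := H.ret y hy by_ (y0.trans_le (min_le_right _ _))
      obtain ⟨b2, e2⟩ := H.ret z hz bz (by simpa [z0] using hr)
      have e1' : -1 * y (0 + P) - h = q * (y 0 - h) := by rw [zero_add]; exact e1
      have e2' : -1 * z (0 + P) = h := by rw [zero_add, ← sub_eq_zero, e2, z0]; simp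
      have := hc _ _ (sol y hy) (sol z hz) b1 b2 e2'
        (by rw [e1']; exact (hq' _).trans_lt (y0.trans_le (min_le_left _ _))) (t - P)
        ⟨by linarith, by linarith [ht.2]⟩
      simp only [sub_add_cancel] at this
      rw [← abs_neg]
      convert this using 2
      ring

/-- By compactness the maximum on `[-1, 0]` is attained, so the strict inequality leaves a uniform
margin. This is what admits arbitrary small perturbations of the initial function to the scalar
reduction. -/
theorem BelowOnDelay.exists_gap {δ : ℝ} {x : ℝ → ℝ} (hx : BelowOnDelay δ x)
    (hc : ContinuousOn x (Icc (-1) 0)) :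
    ∃ κ > 0, ∀ y : ℝ → ℝ, (∀ s ∈ Icc (-1 : ℝ) 0, |y s - x s| < κ) → BelowOnDelay δ y := by
  obtain ⟨s0, hs0, hmax⟩ := isCompact_Icc.exists_isMaxOn (nonempty_Icc.2 (by norm_num)) hc
  refine ⟨-δ - x s0, by linarith [hx s0 hs0], fun y hy s hs => ?_⟩
  have h1 := (abs_lt.1 (hy s hs)).2
  have h2 : x s ≤ x s0 := hmax hs
  linarith

section Stability

variable {a f x : ℝ → ℝ} {δ P q h r : ℝ}

/-- The orbit must stay in the radius where the return map is known. For `|q| < 1` this is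
automatic; in the instability proof it is supplied by the assumed stability. -/
theorem ReturnMap.iterate (hP : 0 ≤ P) (ha : Function.Periodic a P)
    (H : ReturnMap a f δ P 1 q h r) {y : ℝ → ℝ} (hy : IsSolution a f y) (hb : BelowOnDelay δ y)
    {n : ℕ} (hn : ∀ k < n, |q ^ k * (y 0 - h)| < r) :
    IsSolution a f (fun t => y (t + n * P)) ∧ BelowOnDelay δ (fun t => y (t + n * P)) ∧
      y (n * P) - h = q ^ n * (y 0 - h) := by
  induction n with
  | zero => simpa using ⟨hy, hb⟩
  | succ n ih =>
    obtain ⟨s, b, e⟩ := ih fun k hk => hn k (by omega)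
    obtain ⟨b', e'⟩ := H.ret _ s b (by simpa [e] using hn n (by omega))
    have sh : ∀ t, t + P + n * P = t + (n + 1 : ℕ) * P := fun t => by push_cast; ring
    have s' := s.shift hP ha
    simp only [sh] at s'
    refine ⟨s', ?_, ?_⟩
    · simpa only [one_mul, sh] using b'
    · have := sh 0
      rw [zero_add, zero_add] at this
      rw [this, one_mul, zero_add, e, ← mul_assoc] at e'
      rw [e', pow_succ, mul_comm q]

theorem ReturnMap.isAsymptoticallyStable (hP : 0 < P) (hr : 0 < r) (ha : Function.Periodic a P)
    (H : ReturnMap a f δ P 1 q h r) (hq : |q| < 1) (hx : IsSolution a f x)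
    (hb : BelowOnDelay δ x) (hx0 : x 0 = h) (xper : Function.Periodic x P) :
    IsAsymptoticallyStable a f x := by
  obtain ⟨κ, hκ, gap⟩ := hb.exists_gap (hx.1.mono fun s hs => hs.1)
  have main : ∀ y, IsSolution a f y → (∀ s ∈ Icc (-1 : ℝ) 0, |y s - x s| < min κ r) →
      ∀ n : ℕ, IsSolution a f (fun t => y (t + n * P)) ∧ BelowOnDelay δ (fun t => y (t + n * P)) ∧
        y (n * P) - h = q ^ n * (y 0 - h) := by
    intro y hy hyx n
    refine H.iterate hP.le ha hy (gap y fun s hs => (hyx s hs).trans_le (min_le_left _ _)) ?_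
    intro k _
    have := hyx 0 (by simp)
    rw [hx0] at this
    rw [abs_mul, abs_pow]
    have hk : |q| ^ k ≤ 1 := pow_le_one₀ (abs_nonneg _) hq.le
    calc |q| ^ k * |y 0 - h| ≤ 1 * |y 0 - h| := by gcongr
      _ < r := by rw [one_mul]; exact this.trans_le (min_le_right _ _)
  have split : ∀ t : ℝ, 0 ≤ t → ∃ n : ℕ, t - n * P ∈ Icc 0 P ∧ t < (n + 1) * P := by
    intro t ht
    have h1 := Nat.floor_le (a := t / P) (by positivity)
    have h2 := Nat.lt_floor_add_one (t / P)
    rw [le_div_iff₀ hP] at h1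
    rw [div_lt_iff₀ hP] at h2
    exact ⟨⌊t / P⌋₊, ⟨by linarith, by linarith⟩, h2⟩
  -- Closeness of the values at the start of the `n`-th period controls that whole period; stability
  -- and attractivity then both follow from the size of `|q| ^ n * |y 0 - h|`.
  have close : ∀ ε > 0, ∃ η > 0, ∀ y, IsSolution a f y →
      (∀ s ∈ Icc (-1 : ℝ) 0, |y s - x s| < min κ r) → ∀ n : ℕ, |q| ^ n * |y 0 - h| < η →
      ∀ t, t - n * P ∈ Icc 0 P → |y t - x t| < ε := by
    intro ε hε
    obtain ⟨η, hη, hc⟩ := H.cont ε hε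
    refine ⟨η, hη, fun y hy hyx n hn t ht => ?_⟩
    obtain ⟨s, b, e⟩ := main y hy hyx n
    have := hc _ x s hx b hb hx0 (by rw [zero_add, e, abs_mul, abs_pow]; exact hn) _ ht
    rw [sub_add_cancel, xper.sub_nat_mul_eq] at this
    exact this
  refine ⟨fun ε hε => ?_, min κ r, lt_min hκ hr, fun y hy hyx => ?_⟩
  · obtain ⟨η, hη, hc⟩ := close ε hε
    refine ⟨min η (min κ r), lt_min hη (lt_min hκ hr), fun y hy hyx t ht => ?_⟩
    obtain ⟨n, hn, -⟩ := split t ht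
    refine hc y hy (fun s hs => (hyx s hs).trans_le (min_le_right _ _)) n ?_ t hn
    have h0 := hyx 0 (by simp)
    rw [hx0] at h0
    have hk : |q| ^ n ≤ 1 := pow_le_one₀ (abs_nonneg _) hq.le
    calc |q| ^ n * |y 0 - h| ≤ 1 * |y 0 - h| := by gcongr
      _ < η := by rw [one_mul]; exact h0.trans_le (min_le_left _ _)
  · rw [Metric.tendsto_atTop]
    intro ε hε
    obtain ⟨η, hη, hc⟩ := close ε hε
    have lim : Tendsto (fun n : ℕ => |q| ^ n * |y 0 - h|) atTop (𝓝 0) := by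
      simpa using (tendsto_pow_atTop_nhds_zero_of_lt_one (abs_nonneg q) hq).mul_const |y 0 - h|
    obtain ⟨N, hN⟩ := eventually_atTop.1 (lim.eventually_lt_const hη)
    refine ⟨N * P, fun t ht => ?_⟩
    obtain ⟨n, hn, hn'⟩ := split t (le_trans (by positivity) ht)
    have : N ≤ n := by
      have : (N : ℝ) < n + 1 := lt_of_mul_lt_mul_right (ht.trans_lt hn') hP.le
      exact Nat.lt_succ_iff.1 (by exact_mod_cast this)
    rw [Real.dist_eq, sub_zero]
    exact hc y hy hyx n (hN n this) t hn

theorem ReturnMap.isUnstable (hP : 0 < P) (hr : 0 < r) (ha : Function.Periodic a P)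
    (H : ReturnMap a f δ P 1 q h r) (hq : 1 < q) (hx : IsSolution a f x)
    (hb : BelowOnDelay δ x) (hx0 : x 0 = h) (xper : Function.Periodic x P) (xc : Continuous x)
    (hex : ∀ φ : ℝ → ℝ, Continuous φ → ∃ y, IsSolution a f y ∧ ∀ s ≤ 0, y s = φ s) :
    IsUnstable a f x := by
  intro hst
  obtain ⟨κ, hκ, gap⟩ := hb.exists_gap (hx.1.mono fun s hs => hs.1)
  obtain ⟨η, hη, hs⟩ := hst r hr
  set e := min η κ / 2 with he
  have e0 : 0 < e := by have := lt_min hη hκ; positivity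
  have eη : e < η := by have := min_le_left η κ; linarith [lt_min hη hκ]
  have eκ : e < κ := by have := min_le_right η κ; linarith [lt_min hη hκ]
  -- A constant upward perturbation suffices: the offset at the return times is multiplied by `q >
  -- 1` each period, while stability with `ε = r` would keep it below `r`.
  obtain ⟨y, hy, hyx⟩ := hex (fun s => x s + e) (by fun_prop)
  have d : ∀ s ∈ Icc (-1 : ℝ) 0, |y s - x s| = e := fun s hs => by
    rw [hyx s hs.2, add_sub_cancel_left, abs_of_pos e0]
  have yb : BelowOnDelay δ y := gap y fun s hs => (d s hs).trans_lt eκ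
  have cl := hs y hy fun s hs => (d s hs).trans_lt eη
  have y0 : y 0 - h = e := by rw [hyx 0 le_rfl, hx0]; ring
  have bound : ∀ n : ℕ, |q ^ n * (y 0 - h)| < r := by
    intro n
    induction n using Nat.strong_induction_on with
    | _ n ih =>
      have := (H.iterate hP.le ha hy yb ih).2.2
      rw [← this]
      have c := cl (n * P) (by positivity)
      have hxn := xper.nat_mul_eq n
      rwa [hxn, hx0] at c
  have lim : Tendsto (fun n : ℕ => q ^ n * e) atTop atTop :=
    (tendsto_pow_atTop_atTop_of_one_lt hq).atTop_mul_const e0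
  obtain ⟨n, hn⟩ := (lim.eventually_ge_atTop r).exists
  have := bound n
  rw [y0] at this
  linarith [le_abs_self (q ^ n * e)]

/-- A solution with the initial value `h` of the return map is periodic. -/
theorem ReturnMap.periodic_of_nonneg (hP : 0 < P) (hr : 0 < r) (ha : Function.Periodic a P)
    (H : ReturnMap a f δ P 1 q h r) {y : ℝ → ℝ} (hy : IsSolution a f y) (hb : BelowOnDelay δ y)
    (h0 : y 0 = h) {t : ℝ} (ht : 0 ≤ t) : y t = y (modPeriod P t) := by
  obtain ⟨s, b, e⟩ := H.iterate hP.le ha hy hb (n := ⌊t / P⌋₊) (by simp [h0, hr])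
  have m := modPeriod_mem hP t
  have tm : t = modPeriod P t + ⌊t / P⌋₊ * P := by
    rw [modPeriod, Int.fract, natCast_floor_eq_intCast_floor (by positivity)]
    field_simp; ring
  -- Continuous dependence at `h`, applied to two solutions with the same value `h` at `0`, serves
  -- as uniqueness on `[0, P]`.
  refine eq_of_forall_dist_le fun ε hε => ?_
  obtain ⟨η, hη, hc⟩ := H.cont ε hε
  have := hc _ y s hy b hb h0 (by rw [zero_add, e, h0]; simpa using hη) _ ⟨m.1, m.2.le⟩
  rw [← tm] at this
  exact this.le

end Stability

theorem Measurable.intervalIntegrable_of_abs_le {g : ℝ → ℝ} (hg : Measurable g) {M : ℝ}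
    (hM : ∀ x, |g x| ≤ M) (u v : ℝ) : IntervalIntegrable g volume u v :=
  (intervalIntegrable_const (c := M)).mono_fun' hg.aestronglyMeasurable
    (Eventually.of_forall hM)

/-! ### The ramp nonlinearity and its switching integrals -/

section Nonlinearity

theorem fSmooth_of_lt_neg {δ x : ℝ} (hδ : 0 ≤ δ) (hx : x < -δ) : fSmooth δ x = 1 := by
  rcases eq_or_ne δ 0 with rfl | h
  · simp [fSmooth, Real.sign_of_neg (show x < 0 by simpa using hx)]
  · simp [fSmooth, h, hx.le]

theorem fSmooth_neg {δ : ℝ} (hδ : 0 ≤ δ) (x : ℝ) : fSmooth δ (-x) = -fSmooth δ x := by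
  rcases eq_or_ne δ 0 with rfl | h
  · simp [fSmooth, Real.sign_neg]
  · have : 0 < δ := lt_of_le_of_ne hδ h.symm
    simp only [fSmooth, h, if_false]
    split_ifs <;> linarith

theorem fSmooth_of_lt {δ x : ℝ} (hδ : 0 ≤ δ) (hx : δ < x) : fSmooth δ x = -1 := by
  rw [← neg_neg x, fSmooth_neg hδ, fSmooth_of_lt_neg hδ (by linarith)]

theorem fSmooth_eq_max {δ : ℝ} (hδ : 0 < δ) :
    fSmooth δ = fun x => max (-1) (min 1 (-(1 / δ) * x)) := by
  funext x
  simp only [fSmooth, hδ.ne', if_false]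
  have e : -(1 / δ) * x = -(x / δ) := by ring
  rw [e]
  split_ifs with h1 h2
  · have : x / δ ≤ -1 := by rw [div_le_iff₀ hδ]; linarith
    rw [min_eq_left (by linarith), max_eq_right (by norm_num)]
  · have : 1 ≤ x / δ := by rw [le_div_iff₀ hδ]; linarith
    rw [min_eq_right (by linarith), max_eq_left (by linarith)]
  · have h3 : -1 < x / δ := by rw [lt_div_iff₀ hδ]; linarith
    have h4 : x / δ < 1 := by rw [div_lt_iff₀ hδ]; linarith
    rw [min_eq_right (by linarith), max_eq_right (by linarith)]

theorem continuous_fSmooth {δ : ℝ} (hδ : 0 < δ) : Continuous (fSmooth δ) := by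
  rw [fSmooth_eq_max hδ]; fun_prop

theorem abs_fSmooth_le {δ : ℝ} (hδ : 0 ≤ δ) (x : ℝ) : |fSmooth δ x| ≤ 1 := by
  rcases hδ.eq_or_lt with rfl | h
  · rcases Real.sign_apply_eq x with h | h | h <;> simp [fSmooth, h]
  · rw [fSmooth_eq_max h, abs_le]
    exact ⟨le_max_left _ _, max_le (by norm_num) (min_le_left _ _)⟩

theorem measurable_fSmooth {δ : ℝ} (hδ : 0 ≤ δ) : Measurable (fSmooth δ) := by
  rcases hδ.eq_or_lt with rfl | h
  · have : fSmooth 0 = fun x : ℝ => -(if x < 0 then -1 else if 0 < x then 1 else 0) := by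
      funext x; simp [fSmooth, Real.sign]
    rw [this]
    exact (Measurable.ite measurableSet_Iio measurable_const
      (Measurable.ite measurableSet_Ioi measurable_const measurable_const)).neg
  · exact (continuous_fSmooth h).measurable

theorem continuousAt_fSmooth {δ x : ℝ} (hδ : 0 ≤ δ) (hx : x ≠ 0) : ContinuousAt (fSmooth δ) x := by
  rcases hδ.eq_or_lt with rfl | h
  · rcases hx.lt_or_gt with h | h
    · refine (continuousAt_const (y := (1 : ℝ))).congr ?_
      filter_upwards [Iio_mem_nhds h] with y hy
      exact (fSmooth_of_lt_neg le_rfl (by simpa using hy)).symm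
    · refine (continuousAt_const (y := (-1 : ℝ))).congr ?_
      filter_upwards [Ioi_mem_nhds h] with y hy
      exact (fSmooth_of_lt le_rfl hy).symm
  · exact (continuous_fSmooth h).continuousAt

/-- No exceptional point arises at `0`, since the odd ramp and `Real.sign` both vanish there. -/
theorem eventually_fSmooth_eq (x : ℝ) : ∀ᶠ δ in 𝓝[>] (0 : ℝ), fSmooth δ x = fSmooth 0 x := by
  rcases lt_trichotomy x 0 with h | rfl | h
  · filter_upwards [Ioo_mem_nhdsGT (neg_pos.2 h)] with δ hδ
    rw [fSmooth_of_lt_neg hδ.1.le (by linarith [hδ.2]), fSmooth_of_lt_neg le_rfl (by simpa using h)]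
  · filter_upwards [self_mem_nhdsWithin] with δ hδ
    have hδ : 0 < δ := hδ
    simp [fSmooth, hδ.ne', hδ.not_ge]
  · filter_upwards [Ioo_mem_nhdsGT h] with δ hδ
    rw [fSmooth_of_lt hδ.1.le hδ.2, fSmooth_of_lt le_rfl h]

theorem integral_fSmooth_symm {δ : ℝ} (hδ : 0 ≤ δ) (a c ρ : ℝ) :
    ∫ s in (c - ρ)..(c + ρ), fSmooth δ (a * (s - c)) = 0 := by
  rw [intervalIntegral.integral_comp_sub_right (fun s => fSmooth δ (a * s))]
  have h := intervalIntegral.integral_comp_neg (a := -ρ) (b := ρ) (fun s => fSmooth δ (a * s))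
  simp only [mul_neg, fSmooth_neg hδ, intervalIntegral.integral_neg, neg_neg] at h
  have e1 : c - ρ - c = -ρ := by ring
  have e2 : c + ρ - c = ρ := by ring
  rw [e1, e2]
  linarith

end Nonlinearity

theorem integral_mul_fSmooth_of_le {δ a ρ c t : ℝ} {A : ℝ → ℝ} (hδ : 0 ≤ δ) (ha : 0 < a)
    (hρ : a * ρ = δ) (ht : 0 ≤ t) (htc : t ≤ c - ρ) :
    ∫ s in (0 : ℝ)..t, A s * fSmooth δ (a * (s - c)) = ∫ s in (0 : ℝ)..t, A s := by
  refine intervalIntegral.integral_congr_Ioo_of_le ht fun s hs => ?_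
  have : a * (s - c) < a * (-ρ) := mul_lt_mul_of_pos_left (by linarith [hs.2]) ha
  rw [fSmooth_of_lt_neg hδ (by linarith), mul_one]

/-- The integral of a coefficient times a nonlinearity that switches from `1` to `-1` in a symmetric
window around `c` on which the coefficient is constant. -/
theorem integral_mul_fSmooth_of_ge {δ a ρ c t α M : ℝ} {A : ℝ → ℝ} (hA : Measurable A)
    (hAM : ∀ s, |A s| ≤ M) (hδ : 0 ≤ δ) (ha : 0 < a)
    (hρ : a * ρ = δ) (hc : 0 ≤ c - ρ) (htc : c + ρ ≤ t)
    (hα : ∀ s ∈ Ioo (c - ρ) (c + ρ), A s = α) :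
    ∫ s in (0 : ℝ)..t, A s * fSmooth δ (a * (s - c)) =
      2 * (∫ s in (0 : ℝ)..c, A s) - ∫ s in (0 : ℝ)..t, A s := by
  have ρ0 : 0 ≤ ρ := by
    by_contra! h
    nlinarith
  have iA := hA.intervalIntegrable_of_abs_le hAM
  have M0 : 0 ≤ M := (abs_nonneg _).trans (hAM 0)
  have iF : ∀ u v, IntervalIntegrable (fun s => A s * fSmooth δ (a * (s - c))) volume u v := by
    refine Measurable.intervalIntegrable_of_abs_le (M := M)
      (hA.mul ((measurable_fSmooth hδ).comp (by fun_prop))) fun s => ?_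
    rw [abs_mul]
    exact (mul_le_mul (hAM _) (abs_fSmooth_le hδ _) (abs_nonneg _) M0).trans_eq (mul_one M)
  have e1 := integral_mul_fSmooth_of_le (A := A) hδ ha hρ hc le_rfl
  -- In the window the integrand is a constant times a function odd about `c`. The outcome is
  -- therefore that of a sharp switch at `c`.
  have e2 : ∫ s in (c - ρ)..(c + ρ), A s * fSmooth δ (a * (s - c)) = 0 := by
    rw [intervalIntegral.integral_congr_Ioo_of_le (g := fun s => α * fSmooth δ (a * (s - c)))
      (by linarith) fun s hs => by simp only [hα s hs], intervalIntegral.integral_const_mul,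
      integral_fSmooth_symm hδ, mul_zero]
  have e3 : ∫ s in (c + ρ)..t, A s * fSmooth δ (a * (s - c)) = -∫ s in (c + ρ)..t, A s := by
    rw [← intervalIntegral.integral_neg]
    refine intervalIntegral.integral_congr_Ioo_of_le htc fun s hs => ?_
    have : a * ρ < a * (s - c) := mul_lt_mul_of_pos_left (by linarith [hs.1]) ha
    rw [fSmooth_of_lt hδ (by linarith), mul_neg, mul_one]
  have e4 : ∫ s in (c - ρ)..c, A s = α * ρ := by
    rw [intervalIntegral.integral_congr_Ioo_of_le (g := fun _ => α)
      (by linarith) fun s hs => hα s ⟨hs.1, by linarith [hs.2]⟩]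
    simp; ring
  have e5 : ∫ s in c..(c + ρ), A s = α * ρ := by
    rw [intervalIntegral.integral_congr_Ioo_of_le (g := fun _ => α)
      (by linarith) fun s hs => hα s ⟨by linarith [hs.1], hs.2⟩]
    simp; ring
  rw [← intervalIntegral.integral_add_adjacent_intervals (iF 0 (c + ρ)) (iF _ t),
    ← intervalIntegral.integral_add_adjacent_intervals (iF 0 (c - ρ)) (iF _ (c + ρ)), e1, e2, e3,
    ← intervalIntegral.integral_add_adjacent_intervals (iA 0 c) (iA c t),
    ← intervalIntegral.integral_add_adjacent_intervals (iA 0 (c - ρ)) (iA _ c),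
    ← intervalIntegral.integral_add_adjacent_intervals (iA c (c + ρ)) (iA _ t), e4, e5]
  ring

/-! ### The smoothed coefficient and its primitive -/

section Coefficient

variable {a₁ a₂ p₁ p₂ δ : ℝ}

theorem ASmooth_periodic (hT : 0 < p₁ + p₂) (δ : ℝ) :
    Function.Periodic (ASmooth a₁ a₂ p₁ p₂ δ) (p₁ + p₂) := fun t => by
  simp only [ASmooth, coeffStep, modPeriod_periodic hT t]

theorem ASmooth_of_mem {t : ℝ} (h0 : 0 ≤ t) (hT : t < p₁ + p₂) :
    ASmooth a₁ a₂ p₁ p₂ δ t =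
      if δ = 0 then (if t < p₁ then a₁ else a₂) else coeffRamp δ a₁ a₂ p₁ p₂ t := by
  simp only [ASmooth, coeffStep, modPeriod_eq_self h0 hT]

theorem measurable_ASmooth : Measurable (ASmooth a₁ a₂ p₁ p₂ δ) := by
  rcases eq_or_ne δ 0 with rfl | h
  · have : ASmooth a₁ a₂ p₁ p₂ 0 = fun t => if modPeriod (p₁ + p₂) t < p₁ then a₁ else a₂ := by
      funext t; simp [ASmooth, coeffStep]
    rw [this]
    exact Measurable.ite (measurable_modPeriod _ measurableSet_Iio) measurable_const
      measurable_const
  · have : ASmooth a₁ a₂ p₁ p₂ δ =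
        coeffRamp δ a₁ a₂ p₁ p₂ ∘ modPeriod (p₁ + p₂) := by
      funext t; simp [ASmooth, h]
    rw [this]
    refine Measurable.comp ?_ (measurable_modPeriod _)
    exact Measurable.ite measurableSet_Iio (by fun_prop)
      (Measurable.ite measurableSet_Iic (by fun_prop)
      (Measurable.ite measurableSet_Iio (by fun_prop)
      (Measurable.ite measurableSet_Iic (by fun_prop) (by fun_prop))))

theorem continuous_coeffRamp (hδ : 0 < δ) (h1 : 2 * δ < p₁) (h2 : 2 * δ < p₂) :
    Continuous (coeffRamp δ a₁ a₂ p₁ p₂) := by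
  -- Strict comparisons are turned into non-strict ones by swapping branches, the form
  -- `Continuous.if_le` needs.
  have e : coeffRamp δ a₁ a₂ p₁ p₂ = fun r =>
      if δ ≤ r then
        if r ≤ p₁ - δ then a₁
        else if p₁ + δ ≤ r then
          if r ≤ p₁ + p₂ - δ then a₂ else a₂ + (a₁ - a₂) / (2 * δ) * (r - (p₁ + p₂ - δ))
        else a₁ + (a₂ - a₁) / (2 * δ) * (r - (p₁ - δ))
      else a₂ + (a₁ - a₂) / (2 * δ) * (r + δ) := by
    funext r
    simp only [coeffRamp]
    split_ifs <;> first | rfl | linarith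
  rw [e]
  refine Continuous.if_le (Continuous.if_le (by fun_prop) (Continuous.if_le (Continuous.if_le
    (by fun_prop) (by fun_prop) (by fun_prop) (by fun_prop) ?_) (by fun_prop) (by fun_prop)
    (by fun_prop) ?_) (by fun_prop) (by fun_prop) ?_) (by fun_prop) (by fun_prop) (by fun_prop) ?_
  · rintro r rfl; simp
  · rintro r rfl
    rw [if_pos (by linarith)]; field_simp; ring
  · rintro r rfl
    rw [if_neg (by linarith)]; simp
  · rintro r rfl
    rw [if_pos (by linarith)]; field_simp; ring

theorem continuous_ASmooth (hδ : 0 < δ) (h1 : 2 * δ < p₁) (h2 : 2 * δ < p₂) :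
    Continuous (ASmooth a₁ a₂ p₁ p₂ δ) := by
  have : ASmooth a₁ a₂ p₁ p₂ δ =
      fun t => coeffRamp δ a₁ a₂ p₁ p₂ (modPeriod (p₁ + p₂) t) := by
    funext t; simp [ASmooth, hδ.ne']
  rw [this]
  refine continuous_comp_modPeriod (by linarith) (continuous_coeffRamp hδ h1 h2).continuousOn ?_
  simp only [coeffRamp]
  rw [if_pos hδ, if_neg (by linarith), if_neg (by linarith), if_neg (by linarith),
    if_neg (by linarith)]
  field_simp; ring

theorem ASmooth_mem (ha₁ : 0 < a₁) (ha₂ : 0 < a₂) (hδ : 0 ≤ δ) (h1 : 2 * δ < p₁)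
    (h2 : 2 * δ < p₂) (t : ℝ) : ASmooth a₁ a₂ p₁ p₂ δ t ∈ Icc 0 (a₁ + a₂) := by
  have seg : ∀ α β u : ℝ, 0 < δ → 0 < α → 0 < β → 0 ≤ u → u ≤ 2 * δ →
      α + (β - α) / (2 * δ) * u ∈ Icc 0 (α + β) := by
    intro α β u hδ hα hβ h0 hu
    have e : α + (β - α) / (2 * δ) * u = α * (1 - u / (2 * δ)) + β * (u / (2 * δ)) := by ring
    have u0 : 0 ≤ u / (2 * δ) := by positivity
    have u1 : u / (2 * δ) ≤ 1 := by rw [div_le_one (by positivity)]; exact hu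
    rw [e]
    constructor <;> nlinarith
  rcases hδ.eq_or_lt with rfl | hδ
  · simp only [ASmooth, coeffStep, if_true]
    split_ifs <;> constructor <;> linarith
  · simp only [ASmooth, hδ.ne', if_false]
    have m := modPeriod_mem (show 0 < p₁ + p₂ by linarith) t
    set r := modPeriod (p₁ + p₂) t
    have s12 := fun u => seg a₁ a₂ u hδ ha₁ ha₂
    have s21 := fun u => seg a₂ a₁ u hδ ha₂ ha₁
    simp only [add_comm a₂ a₁] at s21
    simp only [coeffRamp]
    split_ifs with c1 c2 c3 c4
    · exact s21 _ (by linarith [m.1]) (by linarith)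
    · constructor <;> linarith
    · exact s12 _ (by linarith) (by linarith)
    · constructor <;> linarith
    · exact s21 _ (by linarith) (by linarith [m.2])

theorem abs_ASmooth_le (ha₁ : 0 < a₁) (ha₂ : 0 < a₂) (hδ : 0 ≤ δ) (h1 : 2 * δ < p₁)
    (h2 : 2 * δ < p₂) (t : ℝ) : |ASmooth a₁ a₂ p₁ p₂ δ t| ≤ a₁ + a₂ := by
  have := ASmooth_mem ha₁ ha₂ hδ h1 h2 t
  rw [abs_of_nonneg this.1]; exact this.2

theorem ASmooth_eq_left (hδ : 0 ≤ δ) (h2 : 2 * δ < p₂) {t : ℝ}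
    (ht : t ∈ Ioo δ (p₁ - δ)) : ASmooth a₁ a₂ p₁ p₂ δ t = a₁ := by
  rw [ASmooth_of_mem (by linarith [ht.1]) (by linarith [ht.2])]
  simp only [coeffRamp]
  rw [if_pos (by linarith [ht.2] : t < p₁), if_neg (by linarith [ht.1] : ¬ t < δ),
    if_pos (by linarith [ht.2] : t ≤ p₁ - δ), ite_self]

theorem ASmooth_eq_right (hδ : 0 ≤ δ) (h1 : 2 * δ < p₁) {t : ℝ}
    (ht : t ∈ Ioo (p₁ + δ) (p₁ + p₂ - δ)) : ASmooth a₁ a₂ p₁ p₂ δ t = a₂ := by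
  obtain ⟨l, u⟩ := ht
  rw [ASmooth_of_mem (by linarith) (by linarith)]
  simp only [coeffRamp]
  rw [if_neg (by linarith : ¬ t < p₁), if_neg (by linarith : ¬ t < δ),
    if_neg (by linarith : ¬ t ≤ p₁ - δ), if_neg (by linarith : ¬ t < p₁ + δ),
    if_pos (by linarith : t ≤ p₁ + p₂ - δ), ite_self]

theorem eventually_ASmooth_eq {t : ℝ} (h0 : 0 < t) (hT : t < p₁ + p₂) (ht : t ≠ p₁) :
    ∀ᶠ δ in 𝓝[>] (0 : ℝ), ASmooth a₁ a₂ p₁ p₂ δ t = ASmooth a₁ a₂ p₁ p₂ 0 t := by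
  rcases ht.lt_or_gt with h | h
  · filter_upwards [Ioo_mem_nhdsGT h0, Ioo_mem_nhdsGT (sub_pos.2 h)] with δ d1 d2
    rw [ASmooth_of_mem h0.le hT, ASmooth_of_mem h0.le hT]
    simp only [coeffRamp]
    rw [if_pos h, if_neg (by linarith [d1.2] : ¬ t < δ),
      if_pos (by linarith [d2.2] : t ≤ p₁ - δ), ite_self, if_pos trivial]
  · filter_upwards [Ioo_mem_nhdsGT h0, Ioo_mem_nhdsGT (sub_pos.2 h), Ioo_mem_nhdsGT (sub_pos.2 hT)]
      with δ d1 d2 d3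
    have := d1.1
    rw [ASmooth_of_mem h0.le hT, ASmooth_of_mem h0.le hT]
    simp only [coeffRamp]
    rw [if_neg (by linarith : ¬ t < p₁), if_neg (by linarith [d1.2] : ¬ t < δ),
      if_neg (by linarith : ¬ t ≤ p₁ - δ), if_neg (by linarith [d2.2] : ¬ t < p₁ + δ),
      if_pos (by linarith [d3.2] : t ≤ p₁ + p₂ - δ), ite_self, if_pos trivial]

theorem integral_eq_of_affine {A : ℝ → ℝ} {u v α β w : ℝ} (huv : u ≤ v)
    (h : ∀ s ∈ Ioo u v, A s = α + β * (s - w)) :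
    ∫ s in u..v, A s = α * (v - u) + β * ((v - w) ^ 2 - (u - w) ^ 2) / 2 := by
  rw [intervalIntegral.integral_congr_Ioo_of_le (g := fun s => α + β * (s - w)) huv h,
    intervalIntegral.integral_eq_sub_of_hasDerivAt
      (f := fun s => α * s + β * (s - w) ^ 2 / 2) (fun s _ => ?_)
      (Continuous.intervalIntegrable (by fun_prop) _ _)]
  · ring
  · have h1 := ((hasDerivAt_id s).const_mul α).add
      ((((hasDerivAt_id s).sub_const w).pow 2).const_mul (β / 2))
    convert h1 using 1
    · funext x; simp; ring
    · simp; ring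

/-- On `[0, δ]` the mean of the half-ramp is `(a₂ + 3 * a₁) / 4`, which exceeds `a₁` by `(a₂ - a₁) /
4`; this is the source of the shift of the initial value. -/
theorem integral_ASmooth_left (ha₁ : 0 < a₁) (ha₂ : 0 < a₂) (hδ : 0 ≤ δ) (h1 : 2 * δ < p₁)
    (h2 : 2 * δ < p₂) {t : ℝ} (ht : t ∈ Icc δ (p₁ - δ)) :
    ∫ s in (0 : ℝ)..t, ASmooth a₁ a₂ p₁ p₂ δ s = a₁ * t + (a₂ - a₁) / 4 * δ := by
  have iA := (measurable_ASmooth (a₁ := a₁) (a₂ := a₂) (p₁ := p₁) (p₂ := p₂)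
    (δ := δ)).intervalIntegrable_of_abs_le (abs_ASmooth_le ha₁ ha₂ hδ h1 h2)
  rw [← intervalIntegral.integral_add_adjacent_intervals (iA 0 δ) (iA δ t),
    integral_eq_of_affine (α := a₁) (β := 0) (w := 0) ht.1 fun s hs => by
      rw [ASmooth_eq_left hδ h2 ⟨hs.1, hs.2.trans_le ht.2⟩]; ring]
  rcases hδ.eq_or_lt with rfl | hδ
  · simp
  · rw [integral_eq_of_affine (α := a₂) (β := (a₁ - a₂) / (2 * δ)) (w := -δ) hδ.le fun s hs => by
      rw [ASmooth_of_mem hs.1.le (by linarith [hs.2]), if_neg hδ.ne', coeffRamp, if_pos hs.2]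
      ring]
    field_simp; ring

theorem integral_ASmooth_right (ha₁ : 0 < a₁) (ha₂ : 0 < a₂) (hδ : 0 ≤ δ) (h1 : 2 * δ < p₁)
    (h2 : 2 * δ < p₂) {t : ℝ} (ht : t ∈ Icc (p₁ + δ) (p₁ + p₂ - δ)) :
    ∫ s in (0 : ℝ)..t, ASmooth a₁ a₂ p₁ p₂ δ s =
      a₁ * p₁ + a₂ * (t - p₁) + (a₂ - a₁) / 4 * δ := by
  have iA := (measurable_ASmooth (a₁ := a₁) (a₂ := a₂) (p₁ := p₁) (p₂ := p₂)
    (δ := δ)).intervalIntegrable_of_abs_le (abs_ASmooth_le ha₁ ha₂ hδ h1 h2)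
  rw [← intervalIntegral.integral_add_adjacent_intervals (iA 0 (p₁ + δ)) (iA _ t),
    ← intervalIntegral.integral_add_adjacent_intervals (iA 0 (p₁ - δ)) (iA _ (p₁ + δ)),
    integral_ASmooth_left ha₁ ha₂ hδ h1 h2 ⟨by linarith, le_rfl⟩,
    integral_eq_of_affine (u := p₁ + δ) (α := a₂) (β := 0) (w := 0) ht.1 fun s hs => by
      rw [ASmooth_eq_right hδ h1 ⟨hs.1, hs.2.trans_le ht.2⟩]; ring]
  rcases hδ.eq_or_lt with rfl | hδ
  · simp
  · rw [integral_eq_of_affine (α := a₁) (β := (a₂ - a₁) / (2 * δ)) (w := p₁ - δ) (by linarith)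
      fun s hs => by
        rw [ASmooth_of_mem (by linarith [hs.1]) (by linarith [hs.2]), if_neg hδ.ne', coeffRamp,
          if_neg (by linarith [hs.1]), if_neg (by linarith [hs.1]), if_pos hs.2]]
    field_simp; ring

theorem integral_ASmooth_period (ha₁ : 0 < a₁) (ha₂ : 0 < a₂) (hδ : 0 ≤ δ) (h1 : 2 * δ < p₁)
    (h2 : 2 * δ < p₂) :
    ∫ s in (0 : ℝ)..(p₁ + p₂), ASmooth a₁ a₂ p₁ p₂ δ s = a₁ * p₁ + a₂ * p₂ := by
  have iA := (measurable_ASmooth (a₁ := a₁) (a₂ := a₂) (p₁ := p₁) (p₂ := p₂)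
    (δ := δ)).intervalIntegrable_of_abs_le (abs_ASmooth_le ha₁ ha₂ hδ h1 h2)
  rw [← intervalIntegral.integral_add_adjacent_intervals (iA 0 (p₁ + p₂ - δ)) (iA _ _),
    integral_ASmooth_right ha₁ ha₂ hδ h1 h2 ⟨by linarith, le_rfl⟩]
  rcases hδ.eq_or_lt with rfl | hδ
  · simp
  · rw [integral_eq_of_affine (α := a₂) (β := (a₁ - a₂) / (2 * δ)) (w := p₁ + p₂ - δ) (by linarith)
      fun s hs => by
        rw [ASmooth_of_mem (by linarith [hs.1]) hs.2, if_neg hδ.ne', coeffRamp,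
          if_neg (by linarith [hs.1]), if_neg (by linarith [hs.1]), if_neg (by linarith [hs.1]),
          if_neg (by linarith [hs.1])]]
    field_simp; ring

theorem integral_ASmooth_mono (ha₁ : 0 < a₁) (ha₂ : 0 < a₂) (hδ : 0 ≤ δ) (h1 : 2 * δ < p₁)
    (h2 : 2 * δ < p₂) : Monotone fun t => ∫ s in (0 : ℝ)..t, ASmooth a₁ a₂ p₁ p₂ δ s := by
  intro u v huv
  have iA := (measurable_ASmooth (a₁ := a₁) (a₂ := a₂) (p₁ := p₁) (p₂ := p₂)
    (δ := δ)).intervalIntegrable_of_abs_le (abs_ASmooth_le ha₁ ha₂ hδ h1 h2)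
  beta_reduce
  rw [← intervalIntegral.integral_add_adjacent_intervals (iA 0 u) (iA u v)]
  linarith [intervalIntegral.integral_nonneg_of_forall (μ := volume) huv fun s =>
    (ASmooth_mem ha₁ ha₂ hδ h1 h2 s).1]

end Coefficient

/-! ### Dominated convergence and solutions along a prescribed profile -/

theorem integral_mul_comp_integrable {a f φ : ℝ → ℝ} {M : ℝ} (ha : Measurable a)
    (hf : Measurable f) (hφ : Continuous φ) (haM : ∀ t, |a t| ≤ M) (hf1 : ∀ x, |f x| ≤ 1) :
    Measurable (fun s => a s * f (φ (s - 1))) ∧ ∀ s, |a s * f (φ (s - 1))| ≤ M := by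
  refine ⟨ha.mul (hf.comp (hφ.measurable.comp (by fun_prop))), fun s => ?_⟩
  rw [abs_mul]
  exact (mul_le_mul (haM _) (hf1 _) (abs_nonneg _) ((abs_nonneg _).trans (haM 0))).trans_eq
    (mul_one M)

/-- Pointwise a.e. convergence with a uniform bound gives `L¹` convergence on `[0, T]`, and the `L¹`
distance bounds the difference of the primitives at all `t` at once. -/
theorem eventually_abs_primitive_sub_lt {ι : Type*} {l : Filter ι} [l.IsCountablyGenerated]
    {G : ι → ℝ → ℝ} {G₀ : ℝ → ℝ} {h : ι → ℝ} {h₀ M T : ℝ} (hT : 0 ≤ T)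
    (hG : ∀ᶠ i in l, Measurable (G i) ∧ ∀ s, |G i s| ≤ M)
    (hG₀ : Measurable G₀ ∧ ∀ s, |G₀ s| ≤ M) (hh : Tendsto h l (𝓝 h₀))
    (hpt : ∀ᵐ s, s ∈ Ioc 0 T → Tendsto (fun i => G i s) l (𝓝 (G₀ s))) {ε : ℝ} (hε : 0 < ε) :
    ∀ᶠ i in l, ∀ t ∈ Icc 0 T,
      |(h i + ∫ s in (0 : ℝ)..t, G i s) - (h₀ + ∫ s in (0 : ℝ)..t, G₀ s)| < ε := by
  have lim : Tendsto (fun i => ∫ s in (0 : ℝ)..T, |G i s - G₀ s|) l (𝓝 0) := by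
    have := intervalIntegral.tendsto_integral_filter_of_dominated_convergence (μ := volume)
      (a := 0) (b := T) (l := l) (F := fun i s => |G i s - G₀ s|) (f := fun _ => 0)
      (fun _ => 2 * M)
      (hG.mono fun i hi => (hi.1.sub hG₀.1).abs.aestronglyMeasurable) ?_
      intervalIntegrable_const ?_
    · simpa using this
    · refine hG.mono fun i hi => Eventually.of_forall fun s _ => ?_
      rw [Real.norm_eq_abs, abs_abs]
      have := abs_sub (G i s) (G₀ s)
      linarith [hi.2 s, hG₀.2 s]
    · filter_upwards [hpt] with s hs hmem
      rw [uIoc_of_le hT] at hmem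
      simpa using ((hs hmem).sub_const (G₀ s)).abs
  have hh' : Tendsto (fun i => |h i - h₀|) l (𝓝 0) := by
    simpa using (hh.sub_const h₀).abs
  filter_upwards [hG, lim.eventually_lt_const (half_pos hε),
    hh'.eventually_lt_const (half_pos hε)] with i hi h1 h2 t ht
  have I1 := hi.1.intervalIntegrable_of_abs_le hi.2
  have I2 := hG₀.1.intervalIntegrable_of_abs_le hG₀.2
  have e : (h i + ∫ s in (0 : ℝ)..t, G i s) - (h₀ + ∫ s in (0 : ℝ)..t, G₀ s) =
      (h i - h₀) + ∫ s in (0 : ℝ)..t, (G i s - G₀ s) := by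
    rw [intervalIntegral.integral_sub (I1 _ _) (I2 _ _)]; ring
  rw [e]
  have h3 := intervalIntegral.abs_integral_le_integral_abs (μ := volume)
    (f := fun s => G i s - G₀ s) ht.1
  have h4 : ∫ s in (0 : ℝ)..t, |G i s - G₀ s| ≤ ∫ s in (0 : ℝ)..T, |G i s - G₀ s| :=
    intervalIntegral.integral_mono_interval le_rfl ht.1 ht.2
      (Eventually.of_forall fun s => abs_nonneg _) ((I1 _ _).sub (I2 _ _)).abs
  have := abs_add_le (h i - h₀) (∫ s in (0 : ℝ)..t, (G i s - G₀ s))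
  linarith

/-- The integral of the equation's right-hand side along the profile `φ`, with initial value
`h`. -/
def profileSolution (a f φ : ℝ → ℝ) (h t : ℝ) : ℝ := h + ∫ s in (0 : ℝ)..t, a s * f (φ (s - 1))

/-- If `f` does not distinguish `profileSolution a f φ h` from `φ`, then `profileSolution a f φ h`
is the solution on `[0, T]` of the equation. -/
theorem IsSolution.eq_profileSolution {a f φ y : ℝ → ℝ} {T h : ℝ} (hy : IsSolution a f y)
    (h0 : y 0 = h) (hinit : ∀ u ∈ Icc (-1 : ℝ) 0, f (y u) = f (φ u))
    (hag : ∀ u ∈ Icc 0 T, f (profileSolution a f φ h u) = f (φ u)) :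
    ∀ t ∈ Icc 0 T, y t = profileSolution a f φ h t := by
  have step : ∀ t : ℝ, 0 ≤ t → (∀ u : ℝ, -1 ≤ u → u ≤ t - 1 → f (y u) = f (φ u)) →
      y t = profileSolution a f φ h t := by
    intro t ht hu
    rw [(hy.2 t ht).2, h0, profileSolution]
    congr 1
    refine intervalIntegral.integral_congr fun s hs => ?_
    rw [uIcc_of_le ht] at hs
    rw [hu (s - 1) (by linarith [hs.1]) (by linarith [hs.2])]
  -- Induction over unit intervals: agreement under `f` up to `n` determines `y` up to `n + 1`,
  -- where `hag` renews the agreement.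
  have key : ∀ n : ℕ, ∀ u : ℝ, -1 ≤ u → u ≤ n → u ≤ T → f (y u) = f (φ u) := by
    intro n
    induction n with
    | zero => exact fun u h1 h2 _ => hinit u ⟨h1, by simpa using h2⟩
    | succ n ih =>
      intro u h1 h2 h3
      push_cast at h2
      rcases le_or_gt u 0 with h | h
      · exact hinit u ⟨h1, h⟩
      · rw [step u h.le fun v hv hv' => ih v hv (by linarith) (by linarith), hag u ⟨h.le, h3⟩]
  intro t ht
  obtain ⟨n, hn⟩ := exists_nat_ge t
  exact step t ht.1 fun u h1 h2 => key n u h1 (by linarith) (by linarith [ht.2])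

/-! ### From switching profiles to return maps and periodic families -/

/-- The profiles `φ H` describe, for `0 ≤ δ ≤ δ₀` and `|H - h| < r`, the sign changes during one
period of the solutions with initial values below `-δ` on `[-1, 0]` and equal to
`H - (a₂ - a₁) / 4 * δ` at `0`. After one period these solutions return, up to the sign `σ`, below
`-δ`, and their initial values have been mapped affinely with slope `q`. -/
structure IsSwitchProfile (a₁ a₂ p₁ p₂ σ q h δ₀ r : ℝ) (φ : ℝ → ℝ → ℝ) : Prop where
  width_pos : 0 < δ₀
  radius_pos : 0 < r
  one_le : 1 ≤ p₁ + p₂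
  left_width : 2 * δ₀ < p₁
  right_width : 2 * δ₀ < p₂
  continuous : Continuous (Function.uncurry φ)
  countable_zeros : ∀ H, {u | φ H u = 0}.Countable
  below : ∀ δ ∈ Icc 0 δ₀, ∀ H, |H - h| < r → ∀ u ∈ Icc (-1 : ℝ) 0, φ H u < -δ
  agree : ∀ δ ∈ Icc 0 δ₀, ∀ H, |H - h| < r → ∀ u ∈ Icc 0 (p₁ + p₂),
    fSmooth δ (profileSolution (ASmooth a₁ a₂ p₁ p₂ δ) (fSmooth δ) (φ H)
      (H - (a₂ - a₁) / 4 * δ) u) = fSmooth δ (φ H u)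
  ret : ∀ δ ∈ Icc 0 δ₀, ∀ H, |H - h| < r → ∀ u ∈ Icc (p₁ + p₂ - 1) (p₁ + p₂),
    σ * profileSolution (ASmooth a₁ a₂ p₁ p₂ δ) (fSmooth δ) (φ H)
      (H - (a₂ - a₁) / 4 * δ) u < -δ
  value : ∀ δ ∈ Icc 0 δ₀, ∀ H, |H - h| < r →
    σ * profileSolution (ASmooth a₁ a₂ p₁ p₂ δ) (fSmooth δ) (φ H)
      (H - (a₂ - a₁) / 4 * δ) (p₁ + p₂) - (h - (a₂ - a₁) / 4 * δ) = q * (H - h)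

/-- As `δ → 0+`, the solutions that start below `-δ` with initial value `h - κ * δ` converge,
uniformly on `[0, P]`, to the one for `δ = 0`. -/
def ConvergesOnPeriod (a₁ a₂ p₁ p₂ κ h P : ℝ) : Prop :=
  ∀ ε > 0, ∀ᶠ δ in 𝓝[>] (0 : ℝ), ∀ y z, IsSolution (ASmooth a₁ a₂ p₁ p₂ δ) (fSmooth δ) y →
    BelowOnDelay δ y → y 0 = h - κ * δ → IsSolution (ASmooth a₁ a₂ p₁ p₂ 0) (fSmooth 0) z →
    BelowOnDelay 0 z → z 0 = h → ∀ t ∈ Icc 0 P, |y t - z t| < ε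

section SwitchProfile

variable {a₁ a₂ p₁ p₂ σ q h δ₀ r : ℝ} {φ : ℝ → ℝ → ℝ}

theorem IsSwitchProfile.eq_profileSolution (hp : IsSwitchProfile a₁ a₂ p₁ p₂ σ q h δ₀ r φ)
    {δ : ℝ} (hδ : δ ∈ Icc 0 δ₀) {H : ℝ} (hH : |H - h| < r) {y : ℝ → ℝ}
    (hy : IsSolution (ASmooth a₁ a₂ p₁ p₂ δ) (fSmooth δ) y) (hb : BelowOnDelay δ y)
    (h0 : y 0 = H - (a₂ - a₁) / 4 * δ) : ∀ t ∈ Icc 0 (p₁ + p₂),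
    y t = profileSolution (ASmooth a₁ a₂ p₁ p₂ δ) (fSmooth δ) (φ H) (H - (a₂ - a₁) / 4 * δ) t :=
  hy.eq_profileSolution h0 (fun u hu => by
    rw [fSmooth_of_lt_neg hδ.1 (hb u hu), fSmooth_of_lt_neg hδ.1 (hp.below δ hδ H hH u hu)])
    (hp.agree δ hδ H hH)

theorem IsSwitchProfile.ae_ne_zero (hp : IsSwitchProfile a₁ a₂ p₁ p₂ σ q h δ₀ r φ) (H : ℝ) :
    ∀ᵐ s : ℝ, φ H (s - 1) ≠ 0 := by
  have : {s : ℝ | φ H (s - 1) = 0}.Countable :=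
    (hp.countable_zeros H).preimage (sub_left_injective (b := (1 : ℝ)))
  simpa using this.ae_notMem volume

theorem IsSwitchProfile.integrand (hp : IsSwitchProfile a₁ a₂ p₁ p₂ σ q h δ₀ r φ)
    (ha₁ : 0 < a₁) (ha₂ : 0 < a₂) {δ : ℝ} (hδ : δ ∈ Icc 0 δ₀) (H : ℝ) :
    Measurable (fun s => ASmooth a₁ a₂ p₁ p₂ δ s * fSmooth δ (φ H (s - 1))) ∧
      ∀ s, |ASmooth a₁ a₂ p₁ p₂ δ s * fSmooth δ (φ H (s - 1))| ≤ a₁ + a₂ :=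
  integral_mul_comp_integrable measurable_ASmooth (measurable_fSmooth hδ.1)
    (hp.continuous.comp (by fun_prop : Continuous fun u : ℝ => (H, u)))
    (abs_ASmooth_le ha₁ ha₂ hδ.1 (by linarith [hp.left_width, hδ.2])
      (by linarith [hp.right_width, hδ.2])) (abs_fSmooth_le hδ.1)

theorem IsSwitchProfile.returnMap (hp : IsSwitchProfile a₁ a₂ p₁ p₂ σ q h δ₀ r φ)
    (ha₁ : 0 < a₁) (ha₂ : 0 < a₂) {δ : ℝ} (hδ : δ ∈ Icc 0 δ₀) :
    ReturnMap (ASmooth a₁ a₂ p₁ p₂ δ) (fSmooth δ) δ (p₁ + p₂) σ q (h - (a₂ - a₁) / 4 * δ) r := by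
  have T1 := hp.one_le
  constructor
  · intro y hy hb h0
    set H := y 0 + (a₂ - a₁) / 4 * δ with hHdef
    have hH : |H - h| < r := by rw [hHdef]; convert h0 using 2; ring
    have e := hp.eq_profileSolution hδ hH hy hb (by rw [hHdef]; ring)
    constructor
    · intro s hs
      beta_reduce
      rw [e (s + (p₁ + p₂)) ⟨by linarith [hs.1], by linarith [hs.2]⟩]
      exact hp.ret δ hδ H hH _ ⟨by linarith [hs.1], by linarith [hs.2]⟩
    · rw [e (p₁ + p₂) ⟨by linarith, le_rfl⟩, hp.value δ hδ H hH, hHdef]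
      ring
  · intro ε hε
    have ev := eventually_abs_primitive_sub_lt (l := 𝓝 h) (T := p₁ + p₂)
      (G := fun H s => ASmooth a₁ a₂ p₁ p₂ δ s * fSmooth δ (φ H (s - 1)))
      (h := fun H => H - (a₂ - a₁) / 4 * δ) (by linarith)
      (Eventually.of_forall fun H => hp.integrand ha₁ ha₂ hδ H) (hp.integrand ha₁ ha₂ hδ h)
      ((continuous_id.sub continuous_const).tendsto h) (by
        -- For `δ = 0` the nonlinearity jumps at `0`, so convergence can fail where the profile
        -- vanishes, a null set.
        filter_upwards [hp.ae_ne_zero h] with s hs _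
        refine Tendsto.const_mul _ ?_
        have hc : Continuous fun H => φ H (s - 1) :=
          hp.continuous.comp (by fun_prop : Continuous fun H : ℝ => (H, s - 1))
        exact (continuousAt_fSmooth hδ.1 hs).tendsto.comp (hc.tendsto h)) hε
    obtain ⟨η, hη, hc⟩ := Metric.eventually_nhds_iff.1 ev
    refine ⟨min η r, lt_min hη hp.radius_pos, fun y z hy hz yb zb z0 y0 t ht => ?_⟩
    set H := y 0 + (a₂ - a₁) / 4 * δ with hHdef
    have hH : |H - h| < min η r := by rw [hHdef]; convert y0 using 2; ring
    rw [hp.eq_profileSolution hδ (hH.trans_le (min_le_right _ _)) hy yb (by rw [hHdef]; ring) t ht,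
      hp.eq_profileSolution hδ (by simpa using hp.radius_pos) hz zb z0 t ht]
    exact hc (by rw [Real.dist_eq]; exact hH.trans_le (min_le_left _ _)) t ht

theorem IsSwitchProfile.convergesOnPeriod (hp : IsSwitchProfile a₁ a₂ p₁ p₂ σ q h δ₀ r φ)
    (ha₁ : 0 < a₁) (ha₂ : 0 < a₂) :
    ConvergesOnPeriod a₁ a₂ p₁ p₂ ((a₂ - a₁) / 4) h (p₁ + p₂) := by
  intro ε hε
  have T1 := hp.one_le
  have d0 : (0 : ℝ) ∈ Icc 0 δ₀ := ⟨le_rfl, hp.width_pos.le⟩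
  have hh : |h - h| < r := by simpa using hp.radius_pos
  have mem : ∀ᶠ δ in 𝓝[>] (0 : ℝ), δ ∈ Icc 0 δ₀ :=
    (Ioo_mem_nhdsGT hp.width_pos : Ioo 0 δ₀ ∈ 𝓝[>] (0 : ℝ)) |> fun h =>
      mem_of_superset h Ioo_subset_Icc_self
  have ev := eventually_abs_primitive_sub_lt (l := 𝓝[>] (0 : ℝ)) (T := p₁ + p₂)
    (G := fun δ s => ASmooth a₁ a₂ p₁ p₂ δ s * fSmooth δ (φ h (s - 1)))
    (h := fun δ => h - (a₂ - a₁) / 4 * δ) (h₀ := h) (by linarith)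
    (mem.mono fun δ hδ => hp.integrand ha₁ ha₂ hδ h) (hp.integrand ha₁ ha₂ d0 h) (by
      refine Tendsto.mono_left ?_ nhdsWithin_le_nhds
      have : Continuous fun δ : ℝ => h - (a₂ - a₁) / 4 * δ := by fun_prop
      simpa using this.tendsto 0) (by
      have n1 : ∀ᵐ s : ℝ, s ≠ p₁ := by simp [ae_iff]
      have n2 : ∀ᵐ s : ℝ, s ≠ p₁ + p₂ := by simp [ae_iff]
      filter_upwards [n1, n2] with s h1 h2 hs
      refine tendsto_nhds_of_eventually_eq ?_
      filter_upwards [eventually_fSmooth_eq (φ h (s - 1)),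
        eventually_ASmooth_eq hs.1 (lt_of_le_of_ne hs.2 h2) h1] with δ e1 e2
      rw [e1, e2]) hε
  filter_upwards [mem, ev] with δ hδ hc y z hy yb y0 hz zb z0 t ht
  have key := hc t ht
  rw [hp.eq_profileSolution hδ hh hy yb y0 t ht,
    hp.eq_profileSolution d0 hh hz zb (by rw [z0]; ring) t ht]
  simpa only [profileSolution, mul_zero, sub_zero] using key

end SwitchProfile

theorem ConvergesOnPeriod.comp_neg {a₁ a₂ p₁ p₂ κ h q δ₀ r : ℝ} (hT : 0 < p₁ + p₂) (hδ₀ : 0 < δ₀)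
    (hr : 0 < r) (hR : ∀ δ ∈ Icc 0 δ₀,
      ReturnMap (ASmooth a₁ a₂ p₁ p₂ δ) (fSmooth δ) δ (p₁ + p₂) (-1) q (h - κ * δ) r)
    (H : ConvergesOnPeriod a₁ a₂ p₁ p₂ κ h (p₁ + p₂)) :
    ConvergesOnPeriod a₁ a₂ p₁ p₂ κ h (2 * (p₁ + p₂)) := by
  have half : ∀ δ ∈ Icc 0 δ₀, ∀ y, IsSolution (ASmooth a₁ a₂ p₁ p₂ δ) (fSmooth δ) y →
      BelowOnDelay δ y → y 0 = h - κ * δ →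
      IsSolution (ASmooth a₁ a₂ p₁ p₂ δ) (fSmooth δ) (fun t => -1 * y (t + (p₁ + p₂))) ∧
      BelowOnDelay δ (fun t => -1 * y (t + (p₁ + p₂))) ∧
      -1 * y (0 + (p₁ + p₂)) = h - κ * δ := by
    intro δ hδ y hy hb h0
    obtain ⟨b, e⟩ := (hR δ hδ).ret y hy hb (by simpa [h0] using hr)
    refine ⟨?_, b, ?_⟩
    · simpa using (hy.shift hT.le (ASmooth_periodic hT δ)).neg (fSmooth_neg hδ.1)
    · rw [zero_add, ← sub_eq_zero, e, h0]; simp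
  intro ε hε
  filter_upwards [H ε hε, Ioo_mem_nhdsGT hδ₀] with δ hc hδ y z hy yb y0 hz zb z0 t ht
  rcases le_or_gt t (p₁ + p₂) with h' | h'
  · exact hc y z hy yb y0 hz zb z0 t ⟨ht.1, h'⟩
  · obtain ⟨s1, b1, e1⟩ := half δ ⟨hδ.1.le, hδ.2.le⟩ y hy yb y0
    obtain ⟨s2, b2, e2⟩ := half 0 ⟨le_rfl, hδ₀.le⟩ z hz zb (by simpa using z0)
    have := hc _ _ s1 b1 e1 s2 b2 (by simpa using e2) (t - (p₁ + p₂))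
      ⟨by linarith, by linarith [ht.2]⟩
    simp only [sub_add_cancel] at this
    rw [← abs_neg]
    convert this using 2
    ring

/-- Return maps around `h - κ * δ`, for all small `δ`, generate a family of periodic
solutions. -/
theorem smoothedPeriodicFamily_of_returnMap {a₁ a₂ p₁ p₂ κ h q δ₀ r P : ℝ}
    {S : (ℝ → ℝ) → (ℝ → ℝ) → (ℝ → ℝ) → Prop} (ha₁ : 0 < a₁) (ha₂ : 0 < a₂)
    (hδ₀ : 0 < δ₀) (hr : 0 < r) (h1 : 2 * δ₀ < p₁) (h2 : 2 * δ₀ < p₂) (hP : 1 ≤ P)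
    (hA : ∀ δ, Function.Periodic (ASmooth a₁ a₂ p₁ p₂ δ) P)
    (hh : ∀ δ ∈ Icc 0 δ₀, h - κ * δ < -δ)
    (hR : ∀ δ ∈ Icc 0 δ₀,
      ReturnMap (ASmooth a₁ a₂ p₁ p₂ δ) (fSmooth δ) δ P 1 q (h - κ * δ) r)
    (hC : ConvergesOnPeriod a₁ a₂ p₁ p₂ κ h P)
    (hS : ∀ δ ∈ Icc 0 δ₀, ∀ x, IsSolution (ASmooth a₁ a₂ p₁ p₂ δ) (fSmooth δ) x →
      BelowOnDelay δ x → x 0 = h - κ * δ → Function.Periodic x P → Continuous x →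
      S (ASmooth a₁ a₂ p₁ p₂ δ) (fSmooth δ) x) :
    SmoothedPeriodicFamily a₁ a₂ p₁ p₂ P h S := by
  have P0 : 0 < P := by linarith
  have ex : ∀ δ, ∃ y, δ ∈ Icc 0 δ₀ →
      IsSolution (ASmooth a₁ a₂ p₁ p₂ δ) (fSmooth δ) y ∧ ∀ s ≤ 0, y s = h - κ * δ := by
    intro δ
    by_cases hδ : δ ∈ Icc 0 δ₀
    · obtain ⟨y, hy⟩ := exists_isSolution (measurable_ASmooth (a₁ := a₁) (a₂ := a₂) (p₁ := p₁)
        (p₂ := p₂) (δ := δ)) (measurable_fSmooth hδ.1) (abs_ASmooth_le ha₁ ha₂ hδ.1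
          (by linarith [hδ.2]) (by linarith [hδ.2])) (abs_fSmooth_le hδ.1)
        (continuous_const (y := h - κ * δ))
      exact ⟨y, fun _ => hy⟩
    · exact ⟨0, fun h => absurd h hδ⟩
  choose Y hY using ex
  have Yb : ∀ δ ∈ Icc 0 δ₀, BelowOnDelay δ (Y δ) := fun δ hδ s hs => by
    rw [(hY δ hδ).2 s hs.2]; exact hh δ hδ
  have Y0 : ∀ δ ∈ Icc 0 δ₀, Y δ 0 = h - κ * δ := fun δ hδ => (hY δ hδ).2 0 le_rfl
  have ext : ∀ δ ∈ Icc 0 δ₀, _ := fun δ hδ => by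
    obtain ⟨b, e⟩ := (hR δ hδ).ret _ (hY δ hδ).1 (Yb δ hδ) (by simpa [Y0 δ hδ] using hr)
    simp only [one_mul] at b e
    exact (hY δ hδ).1.periodicExtension hP (hA δ) (fun x hx => fSmooth_of_lt_neg hδ.1 hx)
      (Yb δ hδ) b (by rw [Y0 δ hδ, ← sub_eq_zero, e, Y0 δ hδ]; simp)
  have xper : ∀ δ, Function.Periodic (fun t => Y δ (modPeriod P t)) P := fun δ t => by
    simp only [modPeriod_periodic P0 t]
  have d0 : (0 : ℝ) ∈ Icc 0 δ₀ := ⟨le_rfl, hδ₀.le⟩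
  refine ⟨δ₀, hδ₀, fun δ t => Y δ (modPeriod P t), ?_, ?_, ⟨Y 0, (hY 0 d0).1, ?_, ?_⟩, ?_⟩
  · intro δ hδ hδ'
    obtain ⟨xc, xb, xy, xi, xe⟩ := ext δ ⟨hδ, hδ'⟩
    have sol : IsSolution (ASmooth a₁ a₂ p₁ p₂ δ) (fSmooth δ) fun t => Y δ (modPeriod P t) :=
      ⟨xc.continuousOn, fun t _ => ⟨xi 0 t, xe t⟩⟩
    refine ⟨xper δ, sol, hS δ ⟨hδ, hδ'⟩ _ sol xb ?_ (xper δ) xc⟩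
    beta_reduce
    rw [xy 0 ⟨le_rfl, P0.le⟩, Y0 δ ⟨hδ, hδ'⟩]
  · intro δ hδ hδ'
    obtain ⟨xc, xb, xy, xi, xe⟩ := ext δ ⟨hδ.le, hδ'⟩
    have gc : Continuous fun t =>
        ASmooth a₁ a₂ p₁ p₂ δ t * fSmooth δ (Y δ (modPeriod P (t - 1))) :=
      (continuous_ASmooth hδ (by linarith) (by linarith)).mul
        ((continuous_fSmooth hδ).comp (xc.comp (continuous_id.sub continuous_const)))
    have hd : ∀ t, HasDerivAt (fun t => Y δ (modPeriod P t))
        (ASmooth a₁ a₂ p₁ p₂ δ t * fSmooth δ (Y δ (modPeriod P (t - 1)))) t := by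
      intro t
      have := (intervalIntegral.integral_hasDerivAt_right (xi 0 t)
        (gc.stronglyMeasurableAtFilter _ _) gc.continuousAt).const_add (Y δ (modPeriod P 0))
      rwa [← funext xe] at this
    refine ⟨contDiff_one_iff_deriv.2 ⟨fun t => (hd t).differentiableAt, ?_⟩, hd⟩
    rw [funext fun t => (hd t).deriv]
    exact gc
  · intro s hs
    rw [(hY 0 d0).2 s hs.2]; ring
  · intro t ht
    exact ((hR 0 d0).periodic_of_nonneg P0 hr (hA 0) (hY 0 d0).1 (Yb 0 d0) (Y0 0 d0) ht).symm
  · rw [Metric.tendstoUniformly_iff]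
    intro ε hε
    filter_upwards [hC ε hε, Ioo_mem_nhdsGT hδ₀] with δ hc hδ t
    have hδ' : δ ∈ Icc 0 δ₀ := ⟨hδ.1.le, hδ.2.le⟩
    have m := modPeriod_mem P0 t
    rw [dist_comm, Real.dist_eq]
    exact hc _ _ (hY δ hδ').1 (Yb δ hδ') (Y0 δ hδ') (hY 0 d0).1 (Yb 0 d0)
      (by simpa using Y0 0 d0) _ ⟨m.1, m.2.le⟩

/-! ### Explicit solutions with one or two zeros -/

theorem abs_profileSolution_sub_le {a f φ : ℝ → ℝ} {M h u v w : ℝ}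
    (hm : Measurable (fun s => a s * f (φ (s - 1))) ∧ ∀ s, |a s * f (φ (s - 1))| ≤ M)
    (huv : u ≤ v) (hvw : v ≤ w) :
    |profileSolution a f φ h v - profileSolution a f φ h u| ≤ M * (w - u) := by
  have I := hm.1.intervalIntegrable_of_abs_le hm.2
  have e : profileSolution a f φ h v - profileSolution a f φ h u =
      ∫ s in u..v, a s * f (φ (s - 1)) := by
    rw [profileSolution, profileSolution,
      ← intervalIntegral.integral_add_adjacent_intervals (I 0 u) (I u v)]
    ring
  have h1 := intervalIntegral.norm_integral_le_of_norm_le_const (a := u) (b := v) (C := M)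
    (f := fun s => a s * f (φ (s - 1))) fun s _ => hm.2 s
  rw [e, ← Real.norm_eq_abs]
  refine h1.trans ?_
  have M0 : 0 ≤ M := (abs_nonneg _).trans (hm.2 0)
  rw [abs_of_nonneg (by linarith)]
  exact mul_le_mul_of_nonneg_left (by linarith) M0

/-- The conditions on `δ` and `H` under which the solution with a single zero per half-period
follows the profile `u ↦ H + a₁ * u`. -/
structure OneZeroAdmissible (a₁ a₂ p₁ p₂ δ H : ℝ) : Prop where
  left_width : 2 * δ < p₁
  right_width : 2 * δ < p₂
  start : H + a₁ * δ < -δ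
  switch : δ + 2 * (a₁ + a₂) * (δ / a₁) < H + a₁ * (p₁ - δ)
  late : p₁ + δ < 1 - H / a₁ - δ / a₁
  early : 1 - H / a₁ + δ / a₁ < p₁ + p₂ - δ
  final : δ < kII a₁ a₂ * H + dII a₁ a₂ p₁ p₂ + (a₂ - a₁) / 4 * δ

/-- Here `c = 1 - H / a₁` is one delay after the zero and `ρ = δ / a₁` the half-width of the switch.
Outside the window of length `2 * ρ` the solution is a signed primitive of the coefficient plus a
constant, so it is monotone; inside, it changes by at most `2 * (a₁ + a₂) * ρ`, which explains that
term in the admissibility conditions. -/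
theorem OneZeroAdmissible.solution {a₁ a₂ p₁ p₂ δ H : ℝ} (ha₁ : 0 < a₁) (ha₂ : 0 < a₂)
    (hδ : 0 ≤ δ) (g : OneZeroAdmissible a₁ a₂ p₁ p₂ δ H) {Z : ℝ → ℝ}
    (hZ : Z = profileSolution (ASmooth a₁ a₂ p₁ p₂ δ) (fSmooth δ) (fun u => H + a₁ * u)
      (H - (a₂ - a₁) / 4 * δ)) :
    (∀ u ∈ Icc 0 δ, Z u < -δ) ∧ (∀ u ∈ Icc δ (p₁ - δ), Z u = H + a₁ * u) ∧
      (∀ u ∈ Icc (p₁ - δ) (p₁ + p₂), δ < Z u) ∧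
      Z (p₁ + p₂) = kII a₁ a₂ * H + dII a₁ a₂ p₁ p₂ + (a₂ - a₁) / 4 * δ := by
  obtain ⟨g1, g2, g3, g4, g5, g6, g7⟩ := g
  set c := 1 - H / a₁ with hc
  set ρ := δ / a₁ with hρ
  have aρ : a₁ * ρ = δ := by rw [hρ]; field_simp
  have ac : a₁ * c = a₁ - H := by rw [hc]; field_simp
  have ρ0 : 0 ≤ ρ := by positivity
  have Mρ : 0 ≤ 2 * (a₁ + a₂) * ρ := by positivity
  have hA := measurable_ASmooth (a₁ := a₁) (a₂ := a₂) (p₁ := p₁) (p₂ := p₂) (δ := δ)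
  have hAM := abs_ASmooth_le ha₁ ha₂ hδ g1 g2
  have Smono := integral_ASmooth_mono ha₁ ha₂ hδ g1 g2
  have Sl := fun t => integral_ASmooth_left (t := t) ha₁ ha₂ hδ g1 g2
  have Sr := fun t => integral_ASmooth_right (t := t) ha₁ ha₂ hδ g1 g2
  have ST := integral_ASmooth_period ha₁ ha₂ hδ g1 g2
  have Z1 : ∀ t, Z t = (H - (a₂ - a₁) / 4 * δ) +
      ∫ s in (0 : ℝ)..t, ASmooth a₁ a₂ p₁ p₂ δ s * fSmooth δ (a₁ * (s - c)) := by
    intro t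
    rw [hZ, profileSolution]
    congr 2
    funext s
    have : H + a₁ * (s - 1) = a₁ * (s - c) := by rw [mul_sub, mul_sub, ac]; ring
    rw [this]
  have Zlip : ∀ u v w, u ≤ v → v ≤ w → |Z v - Z u| ≤ (a₁ + a₂) * (w - u) := by
    intro u v w huv hvw
    rw [hZ]
    exact abs_profileSolution_sub_le (integral_mul_comp_integrable (φ := fun u => H + a₁ * u) hA
      (measurable_fSmooth hδ) (by fun_prop) hAM (abs_fSmooth_le hδ)) huv hvw
  have Za : ∀ t, 0 ≤ t → t ≤ c - ρ → Z t = (H - (a₂ - a₁) / 4 * δ) +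
      ∫ s in (0 : ℝ)..t, ASmooth a₁ a₂ p₁ p₂ δ s := by
    intro t h0 ht
    rw [Z1, integral_mul_fSmooth_of_le hδ ha₁ aρ h0 ht]
  have Zb : ∀ t, c + ρ ≤ t → Z t = (H - (a₂ - a₁) / 4 * δ) +
      (2 * (∫ s in (0 : ℝ)..c, ASmooth a₁ a₂ p₁ p₂ δ s) -
        ∫ s in (0 : ℝ)..t, ASmooth a₁ a₂ p₁ p₂ δ s) := by
    intro t ht
    rw [Z1, integral_mul_fSmooth_of_ge hA hAM hδ ha₁ aρ (by linarith) ht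
      (α := a₂) fun s hs => ASmooth_eq_right hδ g1 ⟨by linarith [hs.1], by linarith [hs.2]⟩]
  have Zmid : ∀ u ∈ Icc δ (p₁ - δ), Z u = H + a₁ * u := by
    intro u hu
    rw [Za u (by linarith [hu.1]) (by linarith [hu.2]), Sl u hu]; ring
  have ZT : Z (p₁ + p₂) = kII a₁ a₂ * H + dII a₁ a₂ p₁ p₂ + (a₂ - a₁) / 4 * δ := by
    rw [Zb _ (by linarith), ST, Sr c ⟨by linarith, by linarith⟩, hc, kII, dII]
    field_simp; ring
  have Zlow : ∀ u ∈ Icc (p₁ - δ) (c - ρ), H + a₁ * (p₁ - δ) ≤ Z u := by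
    intro u hu
    rw [← Zmid (p₁ - δ) ⟨by linarith, le_rfl⟩, Za u (by linarith [hu.1]) hu.2,
      Za (p₁ - δ) (by linarith) (by linarith)]
    linarith [Smono hu.1]
  refine ⟨fun u hu => ?_, Zmid, fun u hu => ?_, ZT⟩
  · have h1 := Zmid δ ⟨le_rfl, by linarith⟩
    rw [Za δ hδ (by linarith)] at h1
    rw [Za u hu.1 (by linarith [hu.2])]
    linarith [Smono hu.2]
  · rcases le_or_gt u (c - ρ) with h1 | h1
    · linarith [Zlow u ⟨hu.1, h1⟩]
    rcases le_or_gt u (c + ρ) with h2 | h2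
    · have h3 := Zlow (c - ρ) ⟨by linarith, le_rfl⟩
      have h4 := (abs_le.1 (Zlip (c - ρ) u (c + ρ) h1.le h2)).1
      have : (a₁ + a₂) * (c + ρ - (c - ρ)) = 2 * (a₁ + a₂) * ρ := by ring
      linarith
    -- After the window the solution decreases, so its value at the end of the period is a lower
    -- bound.
    · have h3 := ZT
      rw [Zb _ (by linarith)] at h3
      rw [Zb u h2.le]
      linarith [Smono hu.2]

/-- The conditions on `δ` and `H` under which the solution with two zeros per period follows the
profile `u ↦ min (H + a₁ * u) (2 * a₁ - H - a₁ * u)`. -/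
structure TwoZeroAdmissible (a₁ a₂ p₁ p₂ δ H : ℝ) : Prop where
  left_width : 2 * δ < p₁
  right_width : 2 * δ < p₂
  start : H + a₁ * δ < -δ
  top : 2 * δ + 2 * (a₁ + a₂) * (δ / a₁) < a₁
  switch : 2 * a₁ - H - a₁ * (p₁ - δ) + 2 * (a₁ + a₂) * (δ / a₁) < -δ
  first_early : 1 - H / a₁ + δ / a₁ < p₁ - δ
  late : p₁ + δ < 3 - H / a₁ - δ / a₁
  early : 3 - H / a₁ + δ / a₁ < p₁ + p₂ - δ
  final : mI a₁ a₂ * H - bI a₁ a₂ p₁ p₂ - (a₂ - a₁) / 4 * δ < -δ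

/-- The switches are centred at `c = 1 - H / a₁`, where the coefficient is `a₁`, and at `c + 2`,
where it is `a₂`. The tent peaks at height `a₁`, and `top` keeps the solution above `δ` throughout
the first window. -/
theorem TwoZeroAdmissible.solution {a₁ a₂ p₁ p₂ δ H : ℝ} (ha₁ : 0 < a₁) (ha₂ : 0 < a₂)
    (hδ : 0 ≤ δ) (g : TwoZeroAdmissible a₁ a₂ p₁ p₂ δ H) {Z : ℝ → ℝ}
    (hZ : Z = profileSolution (ASmooth a₁ a₂ p₁ p₂ δ) (fSmooth δ)
      (fun u => min (H + a₁ * u) (2 * a₁ - H - a₁ * u)) (H - (a₂ - a₁) / 4 * δ)) :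
    (∀ u ∈ Icc 0 δ, Z u < -δ) ∧
      (∀ u ∈ Icc δ (1 - H / a₁ - δ / a₁), Z u = H + a₁ * u) ∧
      (∀ u ∈ Icc (1 - H / a₁ - δ / a₁) (1 - H / a₁ + δ / a₁), δ < Z u) ∧
      (∀ u ∈ Icc (1 - H / a₁ + δ / a₁) (p₁ - δ), Z u = 2 * a₁ - H - a₁ * u) ∧
      (∀ u ∈ Icc (p₁ - δ) (p₁ + p₂), Z u < -δ) ∧
      Z (p₁ + p₂) = mI a₁ a₂ * H - bI a₁ a₂ p₁ p₂ - (a₂ - a₁) / 4 * δ := by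
  obtain ⟨g1, g2, g3, g4, g5, g6, g7, g8, g9⟩ := g
  have e3 : 3 - H / a₁ = 1 - H / a₁ + 2 := by ring
  rw [e3] at g7 g8
  set c := 1 - H / a₁ with hc
  set ρ := δ / a₁ with hρ
  have aρ : a₁ * ρ = δ := by rw [hρ]; field_simp
  have ac : a₁ * c = a₁ - H := by rw [hc]; field_simp
  have ρ0 : 0 ≤ ρ := by positivity
  have Mρ : 0 ≤ 2 * (a₁ + a₂) * ρ := by positivity
  have ρ1 : ρ < 1 := by
    rw [hρ, div_lt_one ha₁]; linarith
  have cρ : δ < c - ρ := by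
    by_contra! h
    have := mul_le_mul_of_nonneg_left h ha₁.le
    rw [mul_sub, aρ, ac] at this
    linarith
  have hA := measurable_ASmooth (a₁ := a₁) (a₂ := a₂) (p₁ := p₁) (p₂ := p₂) (δ := δ)
  have hAM := abs_ASmooth_le ha₁ ha₂ hδ g1 g2
  have Smono := integral_ASmooth_mono ha₁ ha₂ hδ g1 g2
  have Sl := fun t => integral_ASmooth_left (t := t) ha₁ ha₂ hδ g1 g2
  have Sr := fun t => integral_ASmooth_right (t := t) ha₁ ha₂ hδ g1 g2
  have ST := integral_ASmooth_period ha₁ ha₂ hδ g1 g2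
  -- The zeros of the tent are far apart compared with `δ`: at every time at least one of the two
  -- switches is saturated. The nonlinearity along the tent is thus a sum of single switches, each
  -- handled by the one-switch integrals.
  have split : ∀ s, fSmooth δ (min (H + a₁ * (s - 1)) (2 * a₁ - H - a₁ * (s - 1))) =
      1 + fSmooth δ (a₁ * (s - c)) - fSmooth δ (a₁ * (s - (c + 2))) := by
    intro s
    have e1 : H + a₁ * (s - 1) = a₁ * (s - c) := by rw [mul_sub, mul_sub, ac]; ring
    have e2 : 2 * a₁ - H - a₁ * (s - 1) = -(a₁ * (s - (c + 2))) := by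
      rw [mul_sub, mul_sub, mul_add, ac]; ring
    have e4 : a₁ * (s - c) = a₁ * (s - (c + 2)) + 2 * a₁ := by ring
    rw [e1, e2]
    rcases le_total (a₁ * (s - c)) (-(a₁ * (s - (c + 2)))) with h | h
    · rw [min_eq_left h, fSmooth_of_lt_neg hδ (x := a₁ * (s - (c + 2))) (by linarith)]; ring
    · rw [min_eq_right h, fSmooth_neg hδ, fSmooth_of_lt hδ (x := a₁ * (s - c)) (by linarith)]; ring
  have I0 := hA.intervalIntegrable_of_abs_le hAM
  have I1 : ∀ c u v, IntervalIntegrable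
      (fun s => ASmooth a₁ a₂ p₁ p₂ δ s * fSmooth δ (a₁ * (s - c))) volume u v := by
    intro c
    have := integral_mul_comp_integrable (φ := fun s => a₁ * (s + 1 - c)) hA
      (measurable_fSmooth hδ) (by fun_prop) hAM (abs_fSmooth_le hδ)
    simp only [sub_add_cancel] at this
    exact this.1.intervalIntegrable_of_abs_le this.2
  have Z1 : ∀ t, Z t = (H - (a₂ - a₁) / 4 * δ) +
      ((∫ s in (0 : ℝ)..t, ASmooth a₁ a₂ p₁ p₂ δ s) +
      (∫ s in (0 : ℝ)..t, ASmooth a₁ a₂ p₁ p₂ δ s * fSmooth δ (a₁ * (s - c))) -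
      ∫ s in (0 : ℝ)..t, ASmooth a₁ a₂ p₁ p₂ δ s * fSmooth δ (a₁ * (s - (c + 2)))) := by
    intro t
    rw [hZ, profileSolution, ← intervalIntegral.integral_add (I0 _ _) (I1 _ _ _),
      ← intervalIntegral.integral_sub ((I0 _ _).add (I1 _ _ _)) (I1 _ _ _)]
    congr 2
    funext s
    rw [split]; ring
  have Zlip : ∀ u v w, u ≤ v → v ≤ w → |Z v - Z u| ≤ (a₁ + a₂) * (w - u) := by
    intro u v w huv hvw
    rw [hZ]
    exact abs_profileSolution_sub_le (integral_mul_comp_integrable (φ := fun u => min (H + a₁ * u) (2 * a₁ - H - a₁ * u)) hA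
      (measurable_fSmooth hδ) (by fun_prop) hAM (abs_fSmooth_le hδ)) huv hvw
  have Ja : ∀ c' t, 0 ≤ t → t ≤ c' - ρ →
      ∫ s in (0 : ℝ)..t, ASmooth a₁ a₂ p₁ p₂ δ s * fSmooth δ (a₁ * (s - c')) =
      ∫ s in (0 : ℝ)..t, ASmooth a₁ a₂ p₁ p₂ δ s := fun c' t h0 ht =>
    integral_mul_fSmooth_of_le hδ ha₁ aρ h0 ht
  have Jb : ∀ t, c + ρ ≤ t →
      ∫ s in (0 : ℝ)..t, ASmooth a₁ a₂ p₁ p₂ δ s * fSmooth δ (a₁ * (s - c)) =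
      2 * (∫ s in (0 : ℝ)..c, ASmooth a₁ a₂ p₁ p₂ δ s) -
        ∫ s in (0 : ℝ)..t, ASmooth a₁ a₂ p₁ p₂ δ s := fun t ht =>
    integral_mul_fSmooth_of_ge hA hAM hδ ha₁ aρ (by linarith) ht
      (α := a₁) fun s hs => ASmooth_eq_left hδ g2 ⟨by linarith [hs.1], by linarith [hs.2]⟩
  have Jc : ∀ t, c + 2 + ρ ≤ t →
      ∫ s in (0 : ℝ)..t, ASmooth a₁ a₂ p₁ p₂ δ s * fSmooth δ (a₁ * (s - (c + 2))) =
      2 * (∫ s in (0 : ℝ)..(c + 2), ASmooth a₁ a₂ p₁ p₂ δ s) -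
        ∫ s in (0 : ℝ)..t, ASmooth a₁ a₂ p₁ p₂ δ s := fun t ht =>
    integral_mul_fSmooth_of_ge hA hAM hδ ha₁ aρ (by linarith) ht
      (α := a₂) fun s hs => ASmooth_eq_right hδ g1 ⟨by linarith [hs.1], by linarith [hs.2]⟩
  have Za : ∀ t, 0 ≤ t → t ≤ c - ρ → Z t = (H - (a₂ - a₁) / 4 * δ) +
      ∫ s in (0 : ℝ)..t, ASmooth a₁ a₂ p₁ p₂ δ s := by
    intro t h0 ht
    rw [Z1, Ja c t h0 ht, Ja (c + 2) t h0 (by linarith)]; ring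
  have Zb : ∀ t, c + ρ ≤ t → t ≤ c + 2 - ρ → Z t = (H - (a₂ - a₁) / 4 * δ) +
      (2 * (∫ s in (0 : ℝ)..c, ASmooth a₁ a₂ p₁ p₂ δ s) -
        ∫ s in (0 : ℝ)..t, ASmooth a₁ a₂ p₁ p₂ δ s) := by
    intro t h0 ht
    rw [Z1, Jb t h0, Ja (c + 2) t (by linarith) ht]; ring
  have Zc : ∀ t, c + 2 + ρ ≤ t → Z t = (H - (a₂ - a₁) / 4 * δ) +
      (2 * (∫ s in (0 : ℝ)..c, ASmooth a₁ a₂ p₁ p₂ δ s) -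
        2 * (∫ s in (0 : ℝ)..(c + 2), ASmooth a₁ a₂ p₁ p₂ δ s) +
        ∫ s in (0 : ℝ)..t, ASmooth a₁ a₂ p₁ p₂ δ s) := by
    intro t h0
    rw [Z1, Jb t (by linarith), Jc t h0]; ring
  have Zup : ∀ u ∈ Icc δ (c - ρ), Z u = H + a₁ * u := by
    intro u hu
    rw [Za u (by linarith [hu.1]) hu.2, Sl u ⟨hu.1, by linarith [hu.2]⟩]; ring
  have Zdown : ∀ u ∈ Icc (c + ρ) (p₁ - δ), Z u = 2 * a₁ - H - a₁ * u := by
    intro u hu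
    rw [Zb u hu.1 (by linarith [hu.2]), Sl u ⟨by linarith [hu.1], hu.2⟩,
      Sl c ⟨by linarith, by linarith⟩, ac]
    ring
  have ZT : Z (p₁ + p₂) = mI a₁ a₂ * H - bI a₁ a₂ p₁ p₂ - (a₂ - a₁) / 4 * δ := by
    rw [Zc _ (by linarith), ST, Sl c ⟨by linarith, by linarith⟩,
      Sr (c + 2) ⟨by linarith, by linarith⟩, hc, mI, bI]
    field_simp; ring
  have Zhigh : ∀ u ∈ Icc (p₁ - δ) (c + 2 - ρ), Z u ≤ 2 * a₁ - H - a₁ * (p₁ - δ) := by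
    intro u hu
    rw [← Zdown (p₁ - δ) ⟨by linarith, le_rfl⟩, Zb u (by linarith [hu.1]) hu.2,
      Zb (p₁ - δ) (by linarith) (by linarith)]
    linarith [Smono hu.1]
  refine ⟨fun u hu => ?_, Zup, fun u hu => ?_, Zdown, fun u hu => ?_, ZT⟩
  · have h1 := Zup δ ⟨le_rfl, cρ.le⟩
    rw [Za δ hδ cρ.le] at h1
    rw [Za u hu.1 (by linarith [hu.2])]
    linarith [Smono hu.2]
  · have h3 := Zup (c - ρ) ⟨cρ.le, le_rfl⟩
    rw [mul_sub, aρ, ac] at h3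
    have h4 := (abs_le.1 (Zlip (c - ρ) u (c + ρ) hu.1 hu.2)).1
    have : (a₁ + a₂) * (c + ρ - (c - ρ)) = 2 * (a₁ + a₂) * ρ := by ring
    linarith
  · rcases le_or_gt u (c + 2 - ρ) with h1 | h1
    · linarith [Zhigh u ⟨hu.1, h1⟩]
    rcases le_or_gt u (c + 2 + ρ) with h2 | h2
    · have h3 := Zhigh (c + 2 - ρ) ⟨by linarith, le_rfl⟩
      have h4 := (abs_le.1 (Zlip (c + 2 - ρ) u (c + 2 + ρ) h1.le h2)).2
      have : (a₁ + a₂) * (c + 2 + ρ - (c + 2 - ρ)) = 2 * (a₁ + a₂) * ρ := by ring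
      linarith
    · have h3 := ZT
      rw [Zc _ (by linarith)] at h3
      rw [Zc u h2.le]
      linarith [Smono hu.2]

/-! ### Persistence of the shape for small `δ` and nearby initial values -/

theorem Continuous.eventually_lt_nhds {X : Type*} [TopologicalSpace X] {F G : X → ℝ} {x : X}
    (hF : Continuous F) (hG : Continuous G) (h : F x < G x) : ∀ᶠ y in 𝓝 x, F y < G y :=
  (hF.tendsto x).eventually_lt (hG.tendsto x) h

theorem exists_radius_of_eventually {p : ℝ × ℝ → Prop} {h : ℝ} (hp : ∀ᶠ x in 𝓝 ((0 : ℝ), h), p x) :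
    ∃ r > 0, ∀ δ ∈ Icc 0 r, ∀ H, |H - h| < r → p (δ, H) := by
  obtain ⟨ε, hε, H⟩ := Metric.eventually_nhds_iff.1 hp
  -- Halving makes room for the endpoint `δ = r`, since the neighbourhood is an open ball.
  refine ⟨ε / 2, half_pos hε, fun δ hδ H' hH => H ?_⟩
  rw [Prod.dist_eq, max_lt_iff, Real.dist_eq, Real.dist_eq, sub_zero, abs_of_nonneg hδ.1]
  exact ⟨by linarith [hδ.2], by linarith⟩

theorem exists_oneZeroAdmissible {a₁ a₂ p₁ p₂ h : ℝ} (hp₁ : 0 < p₁)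
    (hp₂ : 0 < p₂) (h0 : h < 0) (s1 : 0 < h + a₁ * p₁) (s2 : p₁ < 1 - h / a₁)
    (s3 : 1 - h / a₁ < p₁ + p₂) (s4 : 0 < kII a₁ a₂ * h + dII a₁ a₂ p₁ p₂) :
    ∃ r > 0, ∀ δ ∈ Icc 0 r, ∀ H, |H - h| < r → OneZeroAdmissible a₁ a₂ p₁ p₂ δ H := by
  refine exists_radius_of_eventually
    (p := fun x => OneZeroAdmissible a₁ a₂ p₁ p₂ x.1 x.2) ?_
  have ev := fun (F G : ℝ × ℝ → ℝ) (hF : Continuous F) (hG : Continuous G)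
    (hFG : F (0, h) < G (0, h)) => hF.eventually_lt_nhds hG hFG
  filter_upwards [ev (fun x => 2 * x.1) (fun _ => p₁) (by fun_prop) (by fun_prop) (by simpa),
    ev (fun x => 2 * x.1) (fun _ => p₂) (by fun_prop) (by fun_prop) (by simpa),
    ev (fun x => x.2 + a₁ * x.1) (fun x => -x.1) (by fun_prop) (by fun_prop) (by simpa),
    ev (fun x => x.1 + 2 * (a₁ + a₂) * (x.1 / a₁)) (fun x => x.2 + a₁ * (p₁ - x.1))
      (by fun_prop) (by fun_prop) (by simpa),
    ev (fun x => p₁ + x.1) (fun x => 1 - x.2 / a₁ - x.1 / a₁) (by fun_prop) (by fun_prop)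
      (by simpa),
    ev (fun x => 1 - x.2 / a₁ + x.1 / a₁) (fun x => p₁ + p₂ - x.1) (by fun_prop) (by fun_prop)
      (by simpa),
    ev (fun x => x.1) (fun x => kII a₁ a₂ * x.2 + dII a₁ a₂ p₁ p₂ + (a₂ - a₁) / 4 * x.1)
      (by fun_prop) (by fun_prop) (by simpa)] with x h1 h2 h3 h4 h5 h6 h7
  exact ⟨h1, h2, h3, h4, h5, h6, h7⟩

theorem exists_twoZeroAdmissible {a₁ a₂ p₁ p₂ h : ℝ} (ha₁ : 0 < a₁) (hp₁ : 0 < p₁)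
    (hp₂ : 0 < p₂) (h0 : h < 0) (s1 : 2 * a₁ - h - a₁ * p₁ < 0) (s2 : 1 - h / a₁ < p₁)
    (s3 : p₁ < 3 - h / a₁) (s4 : 3 - h / a₁ < p₁ + p₂)
    (s5 : mI a₁ a₂ * h - bI a₁ a₂ p₁ p₂ < 0) :
    ∃ r > 0, ∀ δ ∈ Icc 0 r, ∀ H, |H - h| < r → TwoZeroAdmissible a₁ a₂ p₁ p₂ δ H := by
  refine exists_radius_of_eventually
    (p := fun x => TwoZeroAdmissible a₁ a₂ p₁ p₂ x.1 x.2) ?_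
  have ev := fun (F G : ℝ × ℝ → ℝ) (hF : Continuous F) (hG : Continuous G)
    (hFG : F (0, h) < G (0, h)) => hF.eventually_lt_nhds hG hFG
  filter_upwards [ev (fun x => 2 * x.1) (fun _ => p₁) (by fun_prop) (by fun_prop) (by simpa),
    ev (fun x => 2 * x.1) (fun _ => p₂) (by fun_prop) (by fun_prop) (by simpa),
    ev (fun x => x.2 + a₁ * x.1) (fun x => -x.1) (by fun_prop) (by fun_prop) (by simpa),
    ev (fun x => 2 * x.1 + 2 * (a₁ + a₂) * (x.1 / a₁)) (fun x => a₁)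
      (by fun_prop) (by fun_prop) (by simpa),
    ev (fun x => 2 * a₁ - x.2 - a₁ * (p₁ - x.1) + 2 * (a₁ + a₂) * (x.1 / a₁)) (fun x => -x.1)
      (by fun_prop) (by fun_prop) (by simpa using s1),
    ev (fun x => 1 - x.2 / a₁ + x.1 / a₁) (fun x => p₁ - x.1) (by fun_prop) (by fun_prop)
      (by simpa),
    ev (fun x => p₁ + x.1) (fun x => 3 - x.2 / a₁ - x.1 / a₁) (by fun_prop) (by fun_prop)
      (by simpa),
    ev (fun x => 3 - x.2 / a₁ + x.1 / a₁) (fun x => p₁ + p₂ - x.1) (by fun_prop) (by fun_prop)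
      (by simpa),
    ev (fun x => mI a₁ a₂ * x.2 - bI a₁ a₂ p₁ p₂ - (a₂ - a₁) / 4 * x.1) (fun x => -x.1)
      (by fun_prop) (by fun_prop) (by simpa using s5)] with x h1 h2 h3 h4 h5 h6 h7 h8 h9
  exact ⟨h1, h2, h3, h4, h5, h6, h7, h8, h9⟩

theorem countable_setOf_affine_eq_zero {a b : ℝ} (ha : a ≠ 0) : {u : ℝ | b + a * u = 0}.Countable :=
  ((countable_singleton (-b / a)).mono) fun u hu => by
    have hu : b + a * u = 0 := hu
    rw [mem_singleton_iff]; field_simp; linarith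

theorem exists_isSwitchProfile_oneZero {a₁ a₂ p₁ p₂ h : ℝ} (ha₁ : 0 < a₁) (ha₂ : 0 < a₂)
    (hp₁ : 0 < p₁) (hp₂ : 0 < p₂) (h0 : h < 0) (s1 : 0 < h + a₁ * p₁) (s2 : p₁ < 1 - h / a₁)
    (s3 : 1 - h / a₁ < p₁ + p₂) (s4 : kII a₁ a₂ * h + dII a₁ a₂ p₁ p₂ = -h) :
    ∃ r, IsSwitchProfile a₁ a₂ p₁ p₂ (-1) (-kII a₁ a₂) h r r fun H u => H + a₁ * u := by
  obtain ⟨r, hr, hg⟩ := exists_oneZeroAdmissible hp₁ hp₂ h0 s1 s2 s3 (by linarith)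
  have gr := hg r ⟨hr.le, le_rfl⟩ h (by simpa using hr)
  have hneg : h / a₁ < 0 := div_neg_of_neg_of_pos h0 ha₁
  refine ⟨r, hr, hr, by linarith, gr.left_width, gr.right_width, by fun_prop,
    fun H => countable_setOf_affine_eq_zero ha₁.ne', ?_, ?_, ?_, ?_⟩
  · intro δ hδ H hH u hu
    have := (hg δ hδ H hH).start
    have h1 : a₁ * u ≤ a₁ * δ := mul_le_mul_of_nonneg_left (by linarith [hu.2, hδ.1]) ha₁.le
    linarith
  · intro δ hδ H hH u hu
    have g := hg δ hδ H hH
    obtain ⟨z1, z2, z3, -⟩ := g.solution ha₁ ha₂ hδ.1 rfl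
    have Mρ : 0 ≤ 2 * (a₁ + a₂) * (δ / a₁) := by have := hδ.1; positivity
    rcases le_or_gt u δ with h1 | h1
    · rw [fSmooth_of_lt_neg hδ.1 (z1 u ⟨hu.1, h1⟩), fSmooth_of_lt_neg hδ.1]
      linarith [g.start, mul_le_mul_of_nonneg_left h1 ha₁.le]
    rcases le_or_gt u (p₁ - δ) with h2 | h2
    · rw [z2 u ⟨h1.le, h2⟩]
    · rw [fSmooth_of_lt hδ.1 (z3 u ⟨h2.le, hu.2⟩), fSmooth_of_lt hδ.1]
      linarith [g.switch, mul_le_mul_of_nonneg_left h2.le ha₁.le]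
  · intro δ hδ H hH u hu
    have g := hg δ hδ H hH
    obtain ⟨z1, z2, z3, -⟩ := g.solution ha₁ ha₂ hδ.1 rfl
    have e1 : a₁ * (δ / a₁) = δ := by field_simp
    have e2 : a₁ * (H / a₁) = H := by field_simp
    -- The switch is over before the period ends, so the zero, one delay earlier, precedes `p₁ + p₂
    -- - 1`.
    have l1 : -(H / a₁) + δ / a₁ < u := by linarith [g.early, hu.1, hδ.1]
    have l2 := mul_lt_mul_of_pos_left l1 ha₁
    have l3 : δ < H + a₁ * u := by rw [mul_add, mul_neg, e1, e2] at l2; linarith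
    rcases le_or_gt u (p₁ - δ) with h2 | h2
    · have h1 : δ ≤ u := by
        by_contra! h
        have := mul_lt_mul_of_pos_left h ha₁
        linarith [g.start, hδ.1]
      rw [z2 u ⟨h1, h2⟩]; linarith
    · linarith [z3 u ⟨h2.le, hu.2⟩]
  · intro δ hδ H hH
    obtain ⟨-, -, -, z4⟩ := (hg δ hδ H hH).solution ha₁ ha₂ hδ.1 rfl
    rw [z4]
    linear_combination -s4

theorem exists_isSwitchProfile_twoZero {a₁ a₂ p₁ p₂ h : ℝ} (ha₁ : 0 < a₁) (ha₂ : 0 < a₂)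
    (hp₁ : 0 < p₁) (hp₂ : 0 < p₂) (h0 : h < 0) (s1 : 2 * a₁ - h - a₁ * p₁ < 0)
    (s2 : 1 - h / a₁ < p₁) (s3 : p₁ < 3 - h / a₁) (s4 : 3 - h / a₁ < p₁ + p₂)
    (s5 : mI a₁ a₂ * h - bI a₁ a₂ p₁ p₂ = h) :
    ∃ r, IsSwitchProfile a₁ a₂ p₁ p₂ 1 (mI a₁ a₂) h r r
      fun H u => min (H + a₁ * u) (2 * a₁ - H - a₁ * u) := by
  obtain ⟨r, hr, hg⟩ := exists_twoZeroAdmissible (a₂ := a₂) ha₁ hp₁ hp₂ h0 s1 s2 s3 s4 (by linarith)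
  have gr := hg r ⟨hr.le, le_rfl⟩ h (by simpa using hr)
  have hneg : h / a₁ < 0 := div_neg_of_neg_of_pos h0 ha₁
  refine ⟨r, hr, hr, by linarith, gr.left_width, gr.right_width, by fun_prop, fun H => ?_,
    ?_, ?_, ?_, ?_⟩
  · refine ((countable_setOf_affine_eq_zero (b := H) ha₁.ne').union
      (countable_setOf_affine_eq_zero (b := 2 * a₁ - H) (neg_ne_zero.2 ha₁.ne'))).mono fun u hu => ?_
    have hu : min (H + a₁ * u) (2 * a₁ - H - a₁ * u) = 0 := hu
    rcases min_choice (H + a₁ * u) (2 * a₁ - H - a₁ * u) with h | h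
    · left; exact h.symm.trans hu
    · right
      change 2 * a₁ - H + -a₁ * u = 0
      linarith [h.symm.trans hu]
  · intro δ hδ H hH u hu
    have := (hg δ hδ H hH).start
    have h1 : a₁ * u ≤ a₁ * δ := mul_le_mul_of_nonneg_left (by linarith [hu.2, hδ.1]) ha₁.le
    exact (min_le_left _ _).trans_lt (by linarith)
  · intro δ hδ H hH u hu
    have g := hg δ hδ H hH
    obtain ⟨z1, z2, z3, z4, z5, -⟩ := g.solution ha₁ ha₂ hδ.1 rfl
    have Mρ : 0 ≤ 2 * (a₁ + a₂) * (δ / a₁) := by have := hδ.1; positivity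
    have e1 : a₁ * (1 - H / a₁ - δ / a₁) = a₁ - H - δ := by field_simp
    have e2 : a₁ * (1 - H / a₁ + δ / a₁) = a₁ - H + δ := by field_simp
    have d0 := hδ.1
    have top := g.top
    rcases le_or_gt u δ with h1 | h1
    · rw [fSmooth_of_lt_neg hδ.1 (z1 u ⟨hu.1, h1⟩), fSmooth_of_lt_neg hδ.1]
      refine (min_le_left _ _).trans_lt ?_
      linarith [g.start, mul_le_mul_of_nonneg_left h1 ha₁.le]
    rcases le_or_gt u (1 - H / a₁ - δ / a₁) with h2 | h2
    · have := mul_le_mul_of_nonneg_left h2 ha₁.le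
      rw [z2 u ⟨h1.le, h2⟩, min_eq_left (by linarith)]
    have l2 := mul_lt_mul_of_pos_left h2 ha₁
    rcases le_or_gt u (1 - H / a₁ + δ / a₁) with h3 | h3
    · have l3 := mul_le_mul_of_nonneg_left h3 ha₁.le
      rw [fSmooth_of_lt hδ.1 (z3 u ⟨h2.le, h3⟩), fSmooth_of_lt hδ.1]
      exact lt_min (by linarith) (by linarith)
    have l3 := mul_lt_mul_of_pos_left h3 ha₁
    rcases le_or_gt u (p₁ - δ) with h4 | h4
    · rw [z4 u ⟨h3.le, h4⟩, min_eq_right (by linarith)]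
    · rw [fSmooth_of_lt_neg hδ.1 (z5 u ⟨h4.le, hu.2⟩), fSmooth_of_lt_neg hδ.1]
      refine (min_le_right _ _).trans_lt ?_
      linarith [g.switch, mul_le_mul_of_nonneg_left h4.le ha₁.le]
  · intro δ hδ H hH u hu
    have g := hg δ hδ H hH
    obtain ⟨z1, z2, z3, z4, z5, -⟩ := g.solution ha₁ ha₂ hδ.1 rfl
    rw [one_mul]
    rcases le_or_gt u (p₁ - δ) with h2 | h2
    · have l1 : 2 - H / a₁ + δ / a₁ < u := by linarith [g.early, hu.1, hδ.1]
      have l2 := mul_lt_mul_of_pos_left l1 ha₁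
      have e1 : a₁ * (2 - H / a₁ + δ / a₁) = 2 * a₁ - H + δ := by field_simp
      rw [z4 u ⟨by linarith, h2⟩]; linarith
    · exact z5 u ⟨h2.le, hu.2⟩
  · intro δ hδ H hH
    obtain ⟨-, -, -, -, -, z6⟩ := (hg δ hδ H hH).solution ha₁ ha₂ hδ.1 rfl
    rw [z6]
    linear_combination s5

/-- The shifted fixed point equals its own image, and images end below `-δ`. -/
theorem IsSwitchProfile.initial_lt {a₁ a₂ p₁ p₂ σ q h δ₀ r : ℝ} {φ : ℝ → ℝ → ℝ}
    (hp : IsSwitchProfile a₁ a₂ p₁ p₂ σ q h δ₀ r φ) :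
    ∀ δ ∈ Icc 0 δ₀, h - (a₂ - a₁) / 4 * δ < -δ := by
  intro δ hδ
  have hh : |h - h| < r := by simpa using hp.radius_pos
  have e := hp.value δ hδ h hh
  have := hp.ret δ hδ h hh (p₁ + p₂) ⟨by linarith, le_rfl⟩
  rw [sub_self, mul_zero] at e
  linarith

/-! ### The two types of periodic solutions -/

theorem smoothedPeriodicFamily_of_twoZero {a₁ a₂ p₁ p₂ : ℝ} (ha₁ : 0 < a₁) (ha₂ : 0 < a₂)
    (hp₁ : 0 < p₁) (hp₂ : 0 < p₂) (hm : mI a₁ a₂ - 1 ≠ 0) (h0 : hI a₁ a₂ p₁ p₂ < 0)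
    (hs : ShapeI a₁ a₂ p₁ p₂) {S : (ℝ → ℝ) → (ℝ → ℝ) → (ℝ → ℝ) → Prop}
    (hS : ∀ (δ h r : ℝ), 0 ≤ δ → 2 * δ < p₁ → 2 * δ < p₂ → 0 < r →
      ReturnMap (ASmooth a₁ a₂ p₁ p₂ δ) (fSmooth δ) δ (p₁ + p₂) 1 (mI a₁ a₂) h r →
      ∀ x, IsSolution (ASmooth a₁ a₂ p₁ p₂ δ) (fSmooth δ) x → BelowOnDelay δ x → x 0 = h →
      Function.Periodic x (p₁ + p₂) → Continuous x →
      S (ASmooth a₁ a₂ p₁ p₂ δ) (fSmooth δ) x) :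
    SmoothedPeriodicFamily a₁ a₂ p₁ p₂ (p₁ + p₂) (hI a₁ a₂ p₁ p₂) S := by
  obtain ⟨s1, s2, s3⟩ := hs
  have fix : (mI a₁ a₂ - 1) * hI a₁ a₂ p₁ p₂ = bI a₁ a₂ p₁ p₂ := by
    rw [hI]; field_simp
  set h := hI a₁ a₂ p₁ p₂
  have e : a₁ * (-h / a₁ + 2) = 2 * a₁ - h := by field_simp; ring
  have l := mul_lt_mul_of_pos_left s1 ha₁
  rw [neg_div] at s1 s2 s3
  obtain ⟨r, hp⟩ := exists_isSwitchProfile_twoZero ha₁ ha₂ hp₁ hp₂ h0 (by linarith) (by linarith)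
    (by linarith) (by linarith) (by linarith)
  have hr := hp.radius_pos
  exact smoothedPeriodicFamily_of_returnMap ha₁ ha₂ hr hr hp.left_width hp.right_width hp.one_le
    (fun δ => ASmooth_periodic (by linarith) δ) hp.initial_lt
    (fun δ hδ => hp.returnMap ha₁ ha₂ hδ) (hp.convergesOnPeriod ha₁ ha₂)
    fun δ hδ => hS δ _ r hδ.1 (by linarith [hδ.2, hp.left_width])
      (by linarith [hδ.2, hp.right_width]) hr (hp.returnMap ha₁ ha₂ hδ)

theorem smoothedPeriodicFamily_of_oneZero {a₁ a₂ p₁ p₂ : ℝ} (ha₁ : 0 < a₁) (ha₂ : 0 < a₂)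
    (hp₁ : 0 < p₁) (hp₂ : 0 < p₂) (hk : |kII a₁ a₂| < 1) (hd : 0 < dII a₁ a₂ p₁ p₂)
    (hs : ShapeII a₁ a₂ p₁ p₂) :
    SmoothedPeriodicFamily a₁ a₂ p₁ p₂ (2 * (p₁ + p₂)) (hII a₁ a₂ p₁ p₂)
      IsAsymptoticallyStable := by
  obtain ⟨s1, s2, s3⟩ := hs
  have k1 : 0 < kII a₁ a₂ + 1 := by linarith [(abs_lt.1 hk).1]
  have fix : (kII a₁ a₂ + 1) * hII a₁ a₂ p₁ p₂ = -dII a₁ a₂ p₁ p₂ := by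
    rw [hII]; field_simp
  have h0 : hII a₁ a₂ p₁ p₂ < 0 := div_neg_of_neg_of_pos (by linarith) k1
  set h := hII a₁ a₂ p₁ p₂
  have e : a₁ * (-h / a₁) = -h := by field_simp
  have l := mul_lt_mul_of_pos_left s1 ha₁
  rw [neg_div] at s1 s2 s3
  obtain ⟨r, hp⟩ := exists_isSwitchProfile_oneZero ha₁ ha₂ hp₁ hp₂ h0 (by linarith) (by linarith)
    (by linarith) (by linarith)
  have hr := hp.radius_pos
  have hT := hp.one_le
  have half := fun δ hδ => hp.returnMap ha₁ ha₂ (δ := δ) hδ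
  have hq : |-kII a₁ a₂| < 1 := by rwa [abs_neg]
  have hA : ∀ δ, Function.Periodic (ASmooth a₁ a₂ p₁ p₂ δ) (2 * (p₁ + p₂)) := fun δ => by
    simpa using (ASmooth_periodic (a₁ := a₁) (a₂ := a₂) (p₁ := p₁) (p₂ := p₂) (by linarith)
      δ).nat_mul 2
  have full := fun δ (hδ : δ ∈ Icc 0 r) => (half δ hδ).comp_neg (by linarith) hr
    (ASmooth_periodic (by linarith) δ) (fSmooth_neg hδ.1) hq
  exact smoothedPeriodicFamily_of_returnMap ha₁ ha₂ hr hr hp.left_width hp.right_width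
    (by linarith) hA hp.initial_lt full
    ((hp.convergesOnPeriod ha₁ ha₂).comp_neg (by linarith) hr hr half)
    fun δ hδ x hx xb x0 xper _ => (full δ hδ).isAsymptoticallyStable (by linarith) hr (hA δ)
      (by rw [abs_pow]; exact pow_lt_one₀ (abs_nonneg _) hq two_ne_zero) hx xb x0 xper

end

theorem theorem4 (a₁ a₂ p₁ p₂ : ℝ) (ha₁ : 0 < a₁) (ha₂ : 0 < a₂) (hp₁ : 0 < p₁) (hp₂ : 0 < p₂) :
    (|mI a₁ a₂| < 1 → 0 < bI a₁ a₂ p₁ p₂ → ShapeI a₁ a₂ p₁ p₂ →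
      SmoothedPeriodicFamily a₁ a₂ p₁ p₂ (p₁ + p₂) (hI a₁ a₂ p₁ p₂) IsAsymptoticallyStable) ∧
    (1 < mI a₁ a₂ → bI a₁ a₂ p₁ p₂ < 0 → ShapeI a₁ a₂ p₁ p₂ →
      SmoothedPeriodicFamily a₁ a₂ p₁ p₂ (p₁ + p₂) (hI a₁ a₂ p₁ p₂) IsUnstable) ∧
    (|kII a₁ a₂| < 1 → 0 < dII a₁ a₂ p₁ p₂ → ShapeII a₁ a₂ p₁ p₂ →
      SmoothedPeriodicFamily a₁ a₂ p₁ p₂ (2 * (p₁ + p₂)) (hII a₁ a₂ p₁ p₂)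
        IsAsymptoticallyStable) := by
  refine ⟨fun hm hb hs => ?_, fun hm hb hs => ?_,
    smoothedPeriodicFamily_of_oneZero ha₁ ha₂ hp₁ hp₂⟩
  · have m1 : mI a₁ a₂ - 1 < 0 := by linarith [(abs_lt.1 hm).2]
    refine smoothedPeriodicFamily_of_twoZero ha₁ ha₂ hp₁ hp₂ m1.ne
      (div_neg_of_pos_of_neg hb m1) hs ?_
    exact fun δ h r _ _ _ hr H x hx xb x0 xper _ =>
      H.isAsymptoticallyStable (by linarith) hr (ASmooth_periodic (by linarith) δ) hm hx xb x0 xper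
  · have m1 : 0 < mI a₁ a₂ - 1 := by linarith
    refine smoothedPeriodicFamily_of_twoZero ha₁ ha₂ hp₁ hp₂ m1.ne'
      (div_neg_of_neg_of_pos hb m1) hs ?_
    exact fun δ h r hδ h1 h2 hr H x hx xb x0 xper xc =>
      H.isUnstable (by linarith) hr (ASmooth_periodic (by linarith) δ) hm hx xb x0 xper xc
        fun ψ hψ => exists_isSolution measurable_ASmooth (measurable_fSmooth hδ)
          (abs_ASmooth_le ha₁ ha₂ hδ h1 h2) (abs_fSmooth_le hδ) hψ
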